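/- Let $d\ge 1$ be an integer and $0<s<1$, and let $(-\Delta)^s$ be the fractional Laplacian, i.e. the Fourier multiplier $(-\Delta)^s u=\mathcal F^{-1}(|\xi|^{2s}\mathcal F u)$ (in the convention $\mathcal F u(\xi)=\int e^{-ix\cdot\xi}u(x)\,dx$). Let $\Omega$ and $D$ be nonempty bounded smooth domains in $\mathbb R^d$ with $\overline D\cap\overline\Omega=\emptyset$, put $\Omega_e:=\mathbb R^d\setminus\overline\Omega$, and let $\phi\in C_c^\infty(\Omega_e)$ be real-valued. For $f\in L^\infty(\Omega)$ with $f\ge 0$, let $u_f\in H^s(\mathbb R^d)$ be the unique real-valued (weak) solution of $$((-\Delta)^s+f)u=0\ \text{ in }\Omega,\qquad u|_{\Omega_e}=\phi,$$ that is, $u_f-\phi$ lies in the closure $\widetilde H^s(\Omega)$ of $C_c^\infty(\Omega)$ in $H^s(\mathbb R^d)$ and the equation holds in the sense of distributions in $\Omega$; let $G(f):=(-\Delta)^s u_f|_D$ (restriction of a distribution to $D$). Then there is a constant $C>0$, depending only on $d$, $s$, the Lebesgue measure $|\Omega|$, the distance $\operatorname{dist}(\Omega,D)=\inf\{|x-y|:x\in\Omega,\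 y\in D\}$ and $\phi$ (in particular independent of $f$), such that for every such $f$ the distribution $G(f)$ is a function in $L^\infty(D)$ and $$\|G(f)\|_{L^\infty(D)}\le C.$$ -/

import Mathlib

open MeasureTheory
open scoped ContDiff FourierTransform ENNReal SchwartzMap

noncomputable section

namespace FracSchrodinger

/-- A nonempty bounded smooth domain of `ℝ^d`: a nonempty, connected, bounded open set which near
each of its boundary points is the sublevel set `{ρ < 0}` of a smooth function `ρ` with nonvanishing
differential at that point. -/
structure IsBoundedSmoothDomain {d : ℕ} (Ω : Set (EuclideanSpace ℝ (Fin d))) : Prop where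
  isOpen : IsOpen Ω
  isConnected : IsConnected Ω
  isBounded : Bornology.IsBounded Ω
  smooth_boundary : ∀ x ∈ frontier Ω, ∃ ρ : EuclideanSpace ℝ (Fin d) → ℝ,
    ContDiff ℝ ∞ ρ ∧ fderiv ℝ ρ x ≠ 0 ∧ ∀ᶠ y in nhds x, (y ∈ Ω ↔ ρ y < 0)

/-- The distance `dist(A, B) = inf {|x - y| : x ∈ A, y ∈ B}` between two sets. -/
def setDist {d : ℕ} (A B : Set (EuclideanSpace ℝ (Fin d))) : ℝ :=
  sInf (Set.image2 dist A B)

/-- The class `C_c^∞(U)`: smooth real functions whose support is a compact subset of `U`. -/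
def IsTestFunction {d : ℕ} (U : Set (EuclideanSpace ℝ (Fin d)))
    (ψ : EuclideanSpace ℝ (Fin d) → ℝ) : Prop :=
  ContDiff ℝ ∞ ψ ∧ HasCompactSupport ψ ∧ tsupport ψ ⊆ U

/-- A real-valued `L²` function on `ℝ^d`, seen as a complex-valued one. -/
def complexify {d : ℕ} (u : Lp ℝ 2 (volume : Measure (EuclideanSpace ℝ (Fin d)))) :
    Lp ℂ 2 (volume : Measure (EuclideanSpace ℝ (Fin d))) :=
  Complex.ofRealCLM.compLp u

/-- The square of the norm of `H^s(ℝ^d)`, namely `∫ (1 + |ξ|²)^s |û(ξ)|² dξ`, with the Fourier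
transform `û(ξ) = ∫ exp(-2πi x·ξ) u(x) dx` (the choice of the frequency unit only changes
the norm to an equivalent one). -/
def sobolevNormSq {d : ℕ} (s : ℝ)
    (u : Lp ℝ 2 (volume : Measure (EuclideanSpace ℝ (Fin d)))) : ℝ≥0∞ :=
  ∫⁻ ξ, ENNReal.ofReal ((1 + ‖ξ‖ ^ 2) ^ s) * ‖𝓕 (complexify u) ξ‖ₑ ^ 2

/-- Membership in `H^s(ℝ^d)`, the `L²`-based Sobolev space defined through the Fourier
transform. -/
def MemH {d : ℕ} (s : ℝ) (u : Lp ℝ 2 (volume : Measure (EuclideanSpace ℝ (Fin d)))) : Prop :=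
  TemperedDistribution.MemSobolev s 2 (complexify u : 𝓢'(EuclideanSpace ℝ (Fin d), ℂ))

/-- Membership in the space `H̃^s(Ω)`, the closure of `C_c^∞(Ω)` in `H^s(ℝ^d)`. -/
def MemHTilde {d : ℕ} (s : ℝ) (Ω : Set (EuclideanSpace ℝ (Fin d)))
    (w : Lp ℝ 2 (volume : Measure (EuclideanSpace ℝ (Fin d)))) : Prop :=
  MemH s w ∧ ∀ ε : ℝ≥0∞, 0 < ε →
    ∃ (ψ : EuclideanSpace ℝ (Fin d) → ℝ)
      (v : Lp ℝ 2 (volume : Measure (EuclideanSpace ℝ (Fin d)))),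
      IsTestFunction Ω ψ ∧ v =ᵐ[volume] ψ ∧ sobolevNormSq s (w - v) < ε

/-- The value `⟨(-Δ)^s u, ψ⟩` of the distribution `(-Δ)^s u = 𝓕⁻¹(|2πξ|^{2s} 𝓕u)` at a test function
`ψ ∈ C_c^∞(ℝ^d)`. In the convention of Mathlib for the Fourier transform the symbol of `(-Δ)^s` is
`|2πξ|^{2s}`. The integrand is integrable for every `u ∈ L²` and `s ≥ 0`. -/
def fracLaplacian {d : ℕ} (s : ℝ) (u : Lp ℝ 2 (volume : Measure (EuclideanSpace ℝ (Fin d))))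
    (ψ : EuclideanSpace ℝ (Fin d) → ℝ) : ℂ :=
  ∫ ξ, (((2 * Real.pi * ‖ξ‖) ^ (2 * s) : ℝ) : ℂ) * 𝓕 (complexify u) ξ *
    𝓕⁻ (fun x ↦ (ψ x : ℂ)) ξ

/-- `u ∈ H^s(ℝ^d)` is a (weak) solution of the exterior value problem
`((-Δ)^s + f) u = 0` in `Ω`, `u = φ` in `ℝ^d \ closure Ω`. The equation holds in the sense of
distributions on `Ω`, and the exterior condition means, as usual, `u - φ ∈ H̃^s(Ω)`. -/
structure IsSolution {d : ℕ} (s : ℝ) (Ω : Set (EuclideanSpace ℝ (Fin d)))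
    (f φ : EuclideanSpace ℝ (Fin d) → ℝ)
    (u : Lp ℝ 2 (volume : Measure (EuclideanSpace ℝ (Fin d)))) : Prop where
  memH : MemH s u
  exterior : ∃ φ' : Lp ℝ 2 (volume : Measure (EuclideanSpace ℝ (Fin d))),
    φ' =ᵐ[volume] φ ∧ MemHTilde s Ω (u - φ')
  equation : ∀ ψ : EuclideanSpace ℝ (Fin d) → ℝ, IsTestFunction Ω ψ →
    fracLaplacian s u ψ + ((∫ x in Ω, f x * u x * ψ x : ℝ) : ℂ) = 0

/-- The restriction of the distribution `(-Δ)^s u` to the open set `D` is the function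
`g ∈ L^∞(D)`. -/
def FracLaplacianEqOn {d : ℕ} (s : ℝ)
    (u : Lp ℝ 2 (volume : Measure (EuclideanSpace ℝ (Fin d))))
    (D : Set (EuclideanSpace ℝ (Fin d))) (g : EuclideanSpace ℝ (Fin d) → ℝ) : Prop :=
  MemLp g ∞ (volume.restrict D) ∧
    ∀ ψ : EuclideanSpace ℝ (Fin d) → ℝ, IsTestFunction D ψ →
      fracLaplacian s u ψ = ((∫ x in D, g x * ψ x : ℝ) : ℂ)

end FracSchrodinger

end

open MeasureTheory
open scoped ContDiff FourierTransform ENNReal SchwartzMap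

noncomputable section

namespace FracSchrodinger

open Set Filter Topology Real
open scoped ComplexConjugate

/-! Write `u = φ + w` with `w ∈ H̃^s(Ω)`. The function `(-Δ)^s φ` is bounded everywhere by the `L¹`
norm of its Fourier transform. Since `D` lies at distance `δ > 0` from `Ω`, on `D` the distribution
`(-Δ)^s w` is the function `x ↦ -∫_Ω w(y) k(|x - y|) dy`, where the kernel `k ≥ 0` is nonincreasing.
It is therefore at most `k(δ) ‖w‖_{L¹(Ω)} ≤ k(δ) |Ω|^{1/2} ‖w‖_{L²}`, and what remains is an `L²`
bound on `w` independent of `f`.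

The kernel formula (`integral_symbol_mul_fourier_mul_fourierInv`, extended to `H̃^s(Ω)` by
`MemHTilde.fracLaplacian_eq_neg_jumpForm`) comes from subordination: `λ^s` is a multiple of `∫ (1 -
exp(-tλ)) t^(-1-s) dt`. Applied to the symbol of `-Δ`, the term `1` contributes the integral of a
product of functions with disjoint supports, which is zero, and the exponential contributes the heat
kernel; integrating in time gives `k`.

The `L²` bound (`norm_sub_le_of_isSolution`) is the energy estimate. Formally, testing the equation
with `w` and dropping `∫ f w² ≥ 0` (`φ` vanishes on `Ω`) bounds the energy of `w` by `K ‖w‖`, with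
`K = ‖(-Δ)^s φ‖_{L²}`; the Poincaré inequality `exists_poincare_const` bounds `‖w‖²` by the energy.
As only functions of `C_c^∞(Ω)` may be tested, this is done on approximations of `w`; the size of
`f` enters only through error terms that vanish in the limit. -/

/-! ### Subordination: powers `a ^ s` as integrals of `1 - exp (-(t * a))`. -/

lemma one_sub_exp_neg_mul_rpow_nonneg (s : ℝ) {a t : ℝ} (ha : 0 ≤ a) (ht : 0 < t) :
    0 ≤ (1 - Real.exp (-(t * a))) * t ^ (-1 - s) := by
  have : Real.exp (-(t * a)) ≤ 1 := Real.exp_le_one_iff.2 (by have := mul_nonneg ht.le ha; linarith)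
  exact mul_nonneg (by linarith) (Real.rpow_nonneg ht.le _)

lemma continuousOn_one_sub_exp_neg_mul_rpow (s a : ℝ) :
    ContinuousOn (fun t : ℝ ↦ (1 - Real.exp (-(t * a))) * t ^ (-1 - s)) (Ioi 0) := by
  refine ContinuousOn.mul (by fun_prop) ?_
  exact ContinuousOn.rpow_const continuousOn_id fun x hx ↦ Or.inl (ne_of_gt hx)

/-- Near `0` the integrand is at most `a * t ^ (-s)`, integrable because `s < 1`; at infinity it is
at most `t ^ (-1 - s)`, integrable because `0 < s`. -/
lemma integrableOn_one_sub_exp_neg_mul_rpow {s : ℝ} (hs0 : 0 < s) (hs1 : s < 1) {a : ℝ}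
    (ha : 0 ≤ a) :
    IntegrableOn (fun t : ℝ ↦ (1 - Real.exp (-(t * a))) * t ^ (-1 - s)) (Ioi 0) := by
  rw [← Ioc_union_Ioi_eq_Ioi zero_le_one]
  have hcont := continuousOn_one_sub_exp_neg_mul_rpow s a
  refine IntegrableOn.union ?_ ?_
  · have h1 : IntegrableOn (fun t : ℝ ↦ a * t ^ (-s)) (Ioc 0 1) :=
      ((intervalIntegrable_iff_integrableOn_Ioc_of_le zero_le_one).1
        (intervalIntegral.intervalIntegrable_rpow' (by linarith))).const_mul a
    refine Integrable.mono' h1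
      ((hcont.mono Ioc_subset_Ioi_self).aestronglyMeasurable measurableSet_Ioc) ?_
    filter_upwards [ae_restrict_mem measurableSet_Ioc] with t ht
    rw [Real.norm_of_nonneg (one_sub_exp_neg_mul_rpow_nonneg s ha ht.1)]
    have h2 : 1 - Real.exp (-(t * a)) ≤ t * a := by
      have := Real.add_one_le_exp (-(t * a)); linarith
    have h3 : t ^ (-s) = t * t ^ (-1 - s) := by
      rw [← Real.rpow_one_add' ht.1.le (by linarith)]; congr 1; ring
    rw [h3]
    calc _ ≤ (t * a) * t ^ (-1 - s) :=
          mul_le_mul_of_nonneg_right h2 (Real.rpow_nonneg ht.1.le _)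
      _ = _ := by ring
  · have h1 : IntegrableOn (fun t : ℝ ↦ t ^ (-1 - s)) (Ioi 1) :=
      integrableOn_Ioi_rpow_of_lt (by linarith) zero_lt_one
    refine Integrable.mono' h1
      ((hcont.mono (Ioi_subset_Ioi zero_le_one)).aestronglyMeasurable measurableSet_Ioi) ?_
    filter_upwards [ae_restrict_mem measurableSet_Ioi] with t ht
    have ht0 : 0 < t := zero_lt_one.trans ht
    rw [Real.norm_of_nonneg (one_sub_exp_neg_mul_rpow_nonneg s ha ht0)]
    exact mul_le_of_le_one_left (Real.rpow_nonneg ht0.le _)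
      (by have := Real.exp_pos (-(t * a)); linarith)

/-- The normalizing constant of the representation of `a ^ s` by `1 - exp (-(t * a))`. -/
def subordinationConst (s : ℝ) : ℝ :=
  ∫ t in Ioi (0 : ℝ), (1 - Real.exp (-(t * 1))) * t ^ (-1 - s)

lemma subordinationConst_pos {s : ℝ} (hs0 : 0 < s) (hs1 : s < 1) : 0 < subordinationConst s := by
  refine (setIntegral_pos_iff_support_of_nonneg_ae ?_
    (integrableOn_one_sub_exp_neg_mul_rpow hs0 hs1 zero_le_one)).2 ?_
  · filter_upwards [ae_restrict_mem measurableSet_Ioi] with t ht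
    exact one_sub_exp_neg_mul_rpow_nonneg s zero_le_one ht
  · have : Ioi (0 : ℝ) ⊆ Function.support
        (fun t : ℝ ↦ (1 - Real.exp (-(t * 1))) * t ^ (-1 - s)) := by
      intro t (ht : 0 < t)
      refine mul_ne_zero ?_ (Real.rpow_pos_of_pos ht _).ne'
      have : Real.exp (-(t * 1)) < 1 := Real.exp_lt_one_iff.2 (by linarith)
      linarith
    rw [inter_eq_self_of_subset_right this]
    simp

lemma integral_one_sub_exp_neg_mul_rpow {s : ℝ} (hs0 : 0 < s) {a : ℝ} (ha : 0 ≤ a) :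
    ∫ t in Ioi (0 : ℝ), (1 - Real.exp (-(t * a))) * t ^ (-1 - s) =
      a ^ s * subordinationConst s := by
  rcases ha.eq_or_lt with rfl | ha
  · simp [Real.zero_rpow hs0.ne']
  · have h := integral_comp_mul_right_Ioi
      (fun t : ℝ ↦ (1 - Real.exp (-(t * 1))) * t ^ (-1 - s)) 0 ha
    rw [zero_mul] at h
    rw [subordinationConst]
    have h2 : ∫ t in Ioi (0 : ℝ), (1 - Real.exp (-(t * a))) * t ^ (-1 - s) =
        a ^ (1 + s) * ∫ t in Ioi (0 : ℝ), (1 - Real.exp (-(t * a * 1))) * (t * a) ^ (-1 - s) := by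
      rw [← integral_const_mul]
      refine setIntegral_congr_fun measurableSet_Ioi fun t (ht : 0 < t) ↦ ?_
      simp only [mul_one]
      rw [Real.mul_rpow ht.le ha.le, show (-1 - s) = -(1 + s) by ring, Real.rpow_neg ha.le]
      have := (Real.rpow_pos_of_pos ha (1 + s)).ne'
      field_simp
    rw [h2, h, smul_eq_mul, ← mul_assoc, Real.rpow_add ha, Real.rpow_one]
    field_simp

/-- The substitution `t ↦ t⁻¹` turns this into the Gamma integral at `p - 1 > 0`. -/
lemma integrableOn_rpow_mul_exp_neg_div {p c : ℝ} (hp : 1 < p) (hc : 0 < c) :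
    IntegrableOn (fun t : ℝ ↦ t ^ (-p) * Real.exp (-(c / t))) (Ioi 0) := by
  have h := Real.GammaIntegral_convergent (s := p - 1) (by linarith)
  have h1 : IntegrableOn (fun u : ℝ ↦ Real.exp (-(c * u)) * u ^ (p - 2)) (Ioi 0) := by
    have h2 := (integrableOn_Ioi_comp_mul_left_iff
      (fun x : ℝ ↦ Real.exp (-x) * x ^ (p - 1 - 1)) 0 hc).2 (by simpa using h)
    refine IntegrableOn.congr_fun
      (f := fun u ↦ c ^ (-(p - 2)) * (Real.exp (-(c * u)) * (c * u) ^ (p - 1 - 1)))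
      (h2.const_mul _) (fun u (hu : 0 < u) ↦ ?_) measurableSet_Ioi
    simp only
    rw [Real.mul_rpow hc.le hu.le, Real.rpow_neg hc.le, show p - 1 - 1 = p - 2 by ring]
    have := (Real.rpow_pos_of_pos hc (p - 2)).ne'
    field_simp
  have h3 := (integrableOn_Ioi_comp_rpow_iff
    (fun u : ℝ ↦ Real.exp (-(c * u)) * u ^ (p - 2)) (p := -1) (by norm_num)).2 h1
  refine h3.congr_fun (fun t (ht : 0 < t) ↦ ?_) measurableSet_Ioi
  simp only [smul_eq_mul, abs_neg, abs_one, one_mul]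
  rw [← Real.rpow_mul ht.le, Real.rpow_neg_one, div_eq_mul_inv]
  rw [mul_left_comm, ← Real.rpow_add ht, mul_comm]
  congr 2
  ring

/-! ### The heat kernel and the Gaussian Fourier multiplier. -/

variable {d : ℕ}

local notation "𝔼" => EuclideanSpace ℝ (Fin d)

/-- The heat kernel of `ℝ^d` at time `t`, as a function of the distance `r`. -/
def heatKernel (d : ℕ) (t r : ℝ) : ℝ :=
  (4 * π * t) ^ (-((d : ℝ) / 2)) * exp (-(r ^ 2 / (4 * t)))

/-- The modulation by `-y` becomes a translation by `y`, so the convolution kernel in both variables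
appears directly. -/
lemma fourierInv_gaussian_modulated {t : ℝ} (ht : 0 < t) (x y : 𝔼) :
    𝓕⁻ (fun ξ : 𝔼 ↦ Complex.exp (-(((4 * π ^ 2 * t : ℝ)) : ℂ) * ‖ξ‖ ^ 2 +
      2 * π * Complex.I * (inner ℝ (-y) ξ : ℝ))) x = (heatKernel d t ‖x - y‖ : ℂ) := by
  have hb : 0 < (((4 * π ^ 2 * t : ℝ)) : ℂ).re := by rw [Complex.ofReal_re]; positivity
  rw [fourierInv_eq_fourier_neg, fourier_gaussian_innerProductSpace' hb, heatKernel]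
  have h1 : ((π : ℂ) / ((4 * π ^ 2 * t : ℝ) : ℂ)) ^ ((Module.finrank ℝ 𝔼 : ℂ) / 2) =
      (((4 * π * t) ^ (-((d : ℝ) / 2)) : ℝ) : ℂ) := by
    rw [Real.rpow_neg (by positivity), ← Real.inv_rpow (by positivity),
      Complex.ofReal_cpow (by positivity), finrank_euclideanSpace_fin]
    congr 1
    · push_cast; field_simp
    · push_cast; rfl
  rw [h1, Complex.ofReal_mul (_ ^ _), Complex.ofReal_exp]
  congr 2
  rw [show -y - -x = x - y by abel]
  push_cast
  field_simp

lemma integrable_gaussian_modulated {t : ℝ} (ht : 0 < t) (y : 𝔼) :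
    Integrable (fun ξ : 𝔼 ↦ Complex.exp (-(((4 * π ^ 2 * t : ℝ)) : ℂ) * ‖ξ‖ ^ 2 +
      2 * π * Complex.I * (inner ℝ (-y) ξ : ℝ))) :=
  GaussianFourier.integrable_cexp_neg_mul_sq_norm_add
    (by rw [Complex.ofReal_re]; positivity) _ _

lemma continuous_fourier_of_integrable {v : 𝔼 → ℂ} (hv : Integrable v) : Continuous (𝓕 v) :=
  VectorFourier.fourierIntegral_continuous Real.continuous_fourierChar
    (by exact continuous_inner) hv

lemma continuous_fourierInv_of_integrable {v : 𝔼 → ℂ} (hv : Integrable v) :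
    Continuous (𝓕⁻ v) := by
  have h : 𝓕⁻ v = fun ξ ↦ 𝓕 v (-ξ) := funext fun ξ ↦ fourierInv_eq_fourier_neg v ξ
  rw [h]
  exact (continuous_fourier_of_integrable hv).comp continuous_neg

lemma norm_fourier_le_integral (v : 𝔼 → ℂ) (ξ : 𝔼) : ‖𝓕 v ξ‖ ≤ ∫ x, ‖v x‖ :=
  VectorFourier.norm_fourierIntegral_le_integral_norm _ _ _ _ _

lemma norm_fourierInv_le_integral (v : 𝔼 → ℂ) (ξ : 𝔼) : ‖𝓕⁻ v ξ‖ ≤ ∫ x, ‖v x‖ := by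
  rw [fourierInv_eq_fourier_neg]; exact norm_fourier_le_integral v _

lemma integral_fourier_mul_eq_flip {v g : 𝔼 → ℂ} (hv : Integrable v) (hg : Integrable g) :
    ∫ ξ, 𝓕 v ξ * g ξ = ∫ x, v x * 𝓕 g x := by
  have h := VectorFourier.integral_fourierIntegral_smul_eq_flip (L := innerₗ 𝔼) (μ := volume)
    (ν := volume) Real.continuous_fourierChar (by exact continuous_inner) hv hg
  rw [flip_innerₗ] at h
  exact h

lemma integral_fourierInv_mul_eq_flip {v g : 𝔼 → ℂ} (hv : Integrable v) (hg : Integrable g) :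
    ∫ ξ, 𝓕⁻ v ξ * g ξ = ∫ x, v x * 𝓕⁻ g x := by
  have hg' : Integrable (fun x ↦ g (-x)) := hg.comp_neg
  have h := integral_fourier_mul_eq_flip hv hg'
  rw [fourierInv_eq_fourier_comp_neg g, ← h,
    ← integral_neg_eq_self (fun ξ ↦ 𝓕 v ξ * g (-ξ))]
  simp only [fourierInv_eq_fourier_neg, neg_neg]

lemma exp_neg_mul_sq_eq (t : ℝ) (ξ : 𝔼) :
    ((exp (-(t * (2 * π * ‖ξ‖) ^ 2)) : ℝ) : ℂ) =
      Complex.exp (-(((4 * π ^ 2 * t : ℝ)) : ℂ) * ‖ξ‖ ^ 2) := by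
  rw [Complex.ofReal_exp]; congr 1; push_cast; ring

lemma integrable_exp_neg_mul_sq {t : ℝ} (ht : 0 < t) :
    Integrable (fun ξ : 𝔼 ↦ ((exp (-(t * (2 * π * ‖ξ‖) ^ 2)) : ℝ) : ℂ)) := by
  have h := integrable_gaussian_modulated ht (0 : 𝔼)
  simp only [neg_zero, inner_zero_left, Complex.ofReal_zero, mul_zero, add_zero] at h
  simpa only [exp_neg_mul_sq_eq] using h

/-- The Gaussian multiplier is convolution with the heat kernel. -/
lemma integral_gaussian_mul_fourier_mul_fourierInv {t : ℝ} (ht : 0 < t) {v ψ : 𝔼 → ℂ}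
    (hv : Integrable v) (hψ : Integrable ψ) :
    ∫ ξ, ((exp (-(t * (2 * π * ‖ξ‖) ^ 2)) : ℝ) : ℂ) * (𝓕 v ξ * 𝓕⁻ ψ ξ) =
      ∫ y, v y * ∫ x, ψ x * (heatKernel d t ‖x - y‖ : ℂ) := by
  have hg : Integrable (fun ξ : 𝔼 ↦ ((exp (-(t * (2 * π * ‖ξ‖) ^ 2)) : ℝ) : ℂ) * 𝓕⁻ ψ ξ) :=
    (integrable_exp_neg_mul_sq ht).mul_bdd (c := ∫ x, ‖ψ x‖)
      (continuous_fourierInv_of_integrable hψ).aestronglyMeasurable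
      (ae_of_all _ (norm_fourierInv_le_integral ψ))
  calc _ = ∫ ξ, 𝓕 v ξ * (((exp (-(t * (2 * π * ‖ξ‖) ^ 2)) : ℝ) : ℂ) * 𝓕⁻ ψ ξ) := by
        congr 1; ext ξ; ring
    _ = ∫ y, v y * 𝓕 (fun ξ ↦ ((exp (-(t * (2 * π * ‖ξ‖) ^ 2)) : ℝ) : ℂ) * 𝓕⁻ ψ ξ) y :=
        integral_fourier_mul_eq_flip hv hg
    _ = _ := by
        congr 1; ext y; congr 1
        simp_rw [← fourierInv_gaussian_modulated ht]
        rw [← integral_fourierInv_mul_eq_flip hψ (integrable_gaussian_modulated ht y),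
          fourier_eq']
        congr 1; ext ξ
        rw [exp_neg_mul_sq_eq, smul_eq_mul, Complex.exp_add]
        have : ((-2 * π * inner ℝ ξ y : ℝ) : ℂ) * Complex.I =
            2 * π * Complex.I * ((inner ℝ (-y) ξ : ℝ) : ℂ) := by
          rw [inner_neg_left, real_inner_comm]; push_cast; ring
        rw [this]; ring

/-! ### The jump kernel and the off-diagonal form of the fractional Laplacian. -/

/-- The jump kernel of `(-Δ)^s` on `ℝ^d`, as a function of the distance `r`: the heat kernel
integrated in time against `t ^ (-1 - s)`. -/
def jumpKernel (d : ℕ) (s r : ℝ) : ℝ :=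
  (subordinationConst s)⁻¹ * ∫ t in Ioi (0 : ℝ), t ^ (-1 - s) * heatKernel d t r

lemma heatKernel_nonneg {t : ℝ} (ht : 0 < t) (r : ℝ) : 0 ≤ heatKernel d t r := by
  unfold heatKernel; positivity

lemma heatKernel_le_heatKernel {t δ r : ℝ} (ht : 0 < t) (hδ : 0 ≤ δ) (hr : δ ≤ r) :
    heatKernel d t r ≤ heatKernel d t δ := by
  unfold heatKernel
  gcongr

lemma heatKernel_le {t : ℝ} (ht : 0 < t) (r : ℝ) :
    heatKernel d t r ≤ (4 * π * t) ^ (-((d : ℝ) / 2)) := by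
  unfold heatKernel
  refine mul_le_of_le_one_right (by positivity) (exp_le_one_iff.2 ?_)
  have : 0 ≤ r ^ 2 / (4 * t) := by positivity
  linarith

lemma measurable_heatKernel : Measurable fun p : ℝ × ℝ ↦ heatKernel d p.1 p.2 := by
  unfold heatKernel
  fun_prop

/-- For `r > 0` the factor `exp (-(r ^ 2 / (4 * t)))` absorbs the singularity `t ^ (-1 - s - d / 2)`
at `t = 0`; this is where separation of supports is needed. -/
lemma integrableOn_rpow_mul_heatKernel {s : ℝ} (hs0 : 0 < s) {r : ℝ} (hr : 0 < r) :
    IntegrableOn (fun t : ℝ ↦ t ^ (-1 - s) * heatKernel d t r) (Ioi 0) := by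
  have hd : (0 : ℝ) ≤ d := d.cast_nonneg
  have h := integrableOn_rpow_mul_exp_neg_div (p := 1 + s + d / 2) (c := r ^ 2 / 4)
    (by linarith) (by positivity)
  refine IntegrableOn.congr_fun (f := fun t ↦ (4 * π) ^ (-((d : ℝ) / 2)) *
    (t ^ (-(1 + s + (d : ℝ) / 2)) * exp (-(r ^ 2 / 4 / t)))) (h.const_mul _)
    (fun t (ht : 0 < t) ↦ ?_) measurableSet_Ioi
  simp only [heatKernel]
  rw [Real.mul_rpow (by positivity) ht.le, div_div,
    show -(1 + s + (d : ℝ) / 2) = (-1 - s) + -((d : ℝ) / 2) by ring, Real.rpow_add ht]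
  ring

lemma jumpKernel_nonneg {s : ℝ} (hs0 : 0 < s) (hs1 : s < 1) (r : ℝ) : 0 ≤ jumpKernel d s r :=
  mul_nonneg (inv_nonneg.2 (subordinationConst_pos hs0 hs1).le)
    (setIntegral_nonneg measurableSet_Ioi fun _ ht ↦
      mul_nonneg (Real.rpow_nonneg (le_of_lt ht) _) (heatKernel_nonneg ht r))

lemma jumpKernel_le_jumpKernel {s : ℝ} (hs0 : 0 < s) (hs1 : s < 1) {δ r : ℝ} (hδ : 0 < δ)
    (hr : δ ≤ r) : jumpKernel d s r ≤ jumpKernel d s δ := by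
  refine mul_le_mul_of_nonneg_left ?_ (inv_nonneg.2 (subordinationConst_pos hs0 hs1).le)
  exact setIntegral_mono_on (integrableOn_rpow_mul_heatKernel hs0 (hδ.trans_le hr))
    (integrableOn_rpow_mul_heatKernel hs0 hδ) measurableSet_Ioi fun t ht ↦
      mul_le_mul_of_nonneg_left (heatKernel_le_heatKernel ht hδ.le hr)
        (Real.rpow_nonneg (le_of_lt ht) _)

lemma measurable_jumpKernel (s : ℝ) : Measurable (jumpKernel d s) := by
  have h : StronglyMeasurable fun p : ℝ × ℝ ↦ p.2 ^ (-1 - s) * heatKernel d p.2 p.1 :=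
    ((measurable_snd.pow_const _).mul
      (measurable_heatKernel.comp measurable_swap)).stronglyMeasurable
  exact (h.integral_prod_right (ν := volume.restrict (Ioi 0))).measurable.const_mul _

/-- Two functions are separated by `δ` if the points where they do not vanish are at distance at
least `δ`. -/
def SeparatedBy (δ : ℝ) (v ψ : 𝔼 → ℂ) : Prop :=
  ∀ y x, v y ≠ 0 → ψ x ≠ 0 → δ ≤ ‖x - y‖

lemma norm_mul_mul_jumpKernel_le {s : ℝ} (hs0 : 0 < s) (hs1 : s < 1) {δ : ℝ} (hδ : 0 < δ)
    {v ψ : 𝔼 → ℂ} (hsep : SeparatedBy δ v ψ) (y x : 𝔼) :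
    ‖v y * ψ x * (jumpKernel d s ‖x - y‖ : ℂ)‖ ≤ jumpKernel d s δ * ‖v y * ψ x‖ := by
  by_cases h : v y * ψ x = 0
  · simp [h]
  · rw [norm_mul, mul_comm, Complex.norm_real, norm_of_nonneg (jumpKernel_nonneg hs0 hs1 _)]
    exact mul_le_mul_of_nonneg_right (jumpKernel_le_jumpKernel hs0 hs1 hδ
      (hsep y x (left_ne_zero_of_mul h) (right_ne_zero_of_mul h))) (norm_nonneg _)

lemma integrable_mul_mul_jumpKernel {s : ℝ} (hs0 : 0 < s) (hs1 : s < 1) {δ : ℝ} (hδ : 0 < δ)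
    {v ψ : 𝔼 → ℂ} (hv : Integrable v) (hψ : Integrable ψ) (hsep : SeparatedBy δ v ψ) :
    Integrable (fun p : 𝔼 × 𝔼 ↦ v p.1 * ψ p.2 * (jumpKernel d s ‖p.2 - p.1‖ : ℂ)) := by
  have hvψ : Integrable (fun p : 𝔼 × 𝔼 ↦ v p.1 * ψ p.2) := hv.mul_prod hψ
  refine Integrable.mono' (hvψ.norm.const_mul (jumpKernel d s δ)) ?_
    (ae_of_all _ fun p ↦ norm_mul_mul_jumpKernel_le hs0 hs1 hδ hsep p.1 p.2)
  refine hvψ.aestronglyMeasurable.mul (Measurable.aestronglyMeasurable ?_)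
  exact Complex.measurable_ofReal.comp ((measurable_jumpKernel s).comp (by fun_prop))

/-- Separation replaces the heat kernel at `‖x - y‖` by its larger value at `δ`, so the dominating
function is a product of a function of time and a function of space. -/
lemma integrable_rpow_mul_heatKernel_prod {s : ℝ} (hs0 : 0 < s) {δ : ℝ} (hδ : 0 < δ)
    {v ψ : 𝔼 → ℂ} (hv : Integrable v) (hψ : Integrable ψ) (hsep : SeparatedBy δ v ψ) :
    Integrable (fun q : ℝ × 𝔼 × 𝔼 ↦
      ((q.1 ^ (-1 - s) * heatKernel d q.1 ‖q.2.2 - q.2.1‖ : ℝ) : ℂ) * (v q.2.1 * ψ q.2.2))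
      ((volume.restrict (Ioi 0)).prod volume) := by
  have hvψ : Integrable (fun p : 𝔼 × 𝔼 ↦ v p.1 * ψ p.2) := hv.mul_prod hψ
  have hdom := (integrableOn_rpow_mul_heatKernel (d := d) hs0 hδ).mul_prod hvψ.norm
  refine Integrable.mono' hdom ?_ ?_
  · refine AEStronglyMeasurable.mul (Measurable.aestronglyMeasurable ?_)
      hvψ.aestronglyMeasurable.comp_snd
    refine Complex.measurable_ofReal.comp ((measurable_fst.pow_const _).mul ?_)
    exact measurable_heatKernel.comp
      (f := fun q : ℝ × 𝔼 × 𝔼 ↦ (q.1, ‖q.2.2 - q.2.1‖)) (by fun_prop)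
  · have hmem : ∀ᵐ q : ℝ × 𝔼 × 𝔼 ∂((volume.restrict (Ioi 0)).prod volume), q.1 ∈ Ioi (0 : ℝ) :=
      Measure.quasiMeasurePreserving_fst.ae (ae_restrict_mem measurableSet_Ioi)
    filter_upwards [hmem] with q (hq : 0 < q.1)
    by_cases h : v q.2.1 * ψ q.2.2 = 0
    · simp [h]
    · rw [norm_mul, Complex.norm_real, norm_of_nonneg
        (mul_nonneg (Real.rpow_nonneg hq.le _) (heatKernel_nonneg hq _))]
      have := heatKernel_le_heatKernel (d := d) hq hδ.le
        (hsep _ _ (left_ne_zero_of_mul h) (right_ne_zero_of_mul h))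
      gcongr

lemma integral_gaussian_mul_eq_integral_prod {t : ℝ} (ht : 0 < t) {v ψ : 𝔼 → ℂ}
    (hv : Integrable v) (hψ : Integrable ψ) :
    ∫ ξ, ((exp (-(t * (2 * π * ‖ξ‖) ^ 2)) : ℝ) : ℂ) * (𝓕 v ξ * 𝓕⁻ ψ ξ) =
      ∫ p : 𝔼 × 𝔼, (heatKernel d t ‖p.2 - p.1‖ : ℂ) * (v p.1 * ψ p.2) := by
  have hvψ : Integrable (fun p : 𝔼 × 𝔼 ↦ v p.1 * ψ p.2) := hv.mul_prod hψ
  have hint : Integrable (fun p : 𝔼 × 𝔼 ↦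
      (heatKernel d t ‖p.2 - p.1‖ : ℂ) * (v p.1 * ψ p.2)) (volume.prod volume) := by
    refine hvψ.bdd_mul (c := (4 * π * t) ^ (-((d : ℝ) / 2))) (Measurable.aestronglyMeasurable ?_)
      (ae_of_all _ fun p ↦ ?_)
    · exact Complex.measurable_ofReal.comp (measurable_heatKernel.comp
        (f := fun p : 𝔼 × 𝔼 ↦ (t, ‖p.2 - p.1‖)) (by fun_prop))
    · rw [Complex.norm_real, norm_of_nonneg (heatKernel_nonneg ht _)]
      exact heatKernel_le ht _
  rw [integral_gaussian_mul_fourier_mul_fourierInv ht hv hψ, Measure.volume_eq_prod,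
    integral_prod _ hint]
  congr 1; ext y
  rw [← integral_const_mul]
  congr 1; ext x; ring

lemma symbol_eq_integral {s : ℝ} (hs0 : 0 < s) (hs1 : s < 1) (ξ : 𝔼) :
    (2 * π * ‖ξ‖) ^ (2 * s) = (subordinationConst s)⁻¹ *
      ∫ t in Ioi (0 : ℝ), (1 - exp (-(t * (2 * π * ‖ξ‖) ^ 2))) * t ^ (-1 - s) := by
  rw [integral_one_sub_exp_neg_mul_rpow hs0 (by positivity), Real.rpow_mul (by positivity),
    Real.rpow_two]
  field_simp [(subordinationConst_pos hs0 hs1).ne']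

/-- The bilinear form of `(-Δ)^s` on functions with separated supports is given by the jump
kernel. -/
theorem integral_symbol_mul_fourier_mul_fourierInv {s : ℝ} (hs0 : 0 < s) (hs1 : s < 1) {δ : ℝ}
    (hδ : 0 < δ) {v ψ : 𝔼 → ℂ} (hv : Integrable v) (hψ : Integrable ψ)
    (hsep : SeparatedBy δ v ψ) (hint : Integrable (fun ξ ↦ 𝓕 v ξ * 𝓕⁻ ψ ξ))
    (hsymb : Integrable (fun ξ ↦ (((2 * π * ‖ξ‖) ^ (2 * s) : ℝ) : ℂ) * (𝓕 v ξ * 𝓕⁻ ψ ξ)))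
    (hzero : ∫ ξ, 𝓕 v ξ * 𝓕⁻ ψ ξ = 0) :
    ∫ ξ, (((2 * π * ‖ξ‖) ^ (2 * s) : ℝ) : ℂ) * (𝓕 v ξ * 𝓕⁻ ψ ξ) =
      -∫ p : 𝔼 × 𝔼, v p.1 * ψ p.2 * (jumpKernel d s ‖p.2 - p.1‖ : ℂ) := by
  set h : 𝔼 → ℂ := fun ξ ↦ 𝓕 v ξ * 𝓕⁻ ψ ξ with hh
  set J := subordinationConst s with hJ
  have hJ0 : J ≠ 0 := (subordinationConst_pos hs0 hs1).ne'
  have hcont : Continuous h :=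
    (continuous_fourier_of_integrable hv).mul (continuous_fourierInv_of_integrable hψ)
  set A : ℝ → 𝔼 → ℝ := fun t ξ ↦ (1 - exp (-(t * (2 * π * ‖ξ‖) ^ 2))) * t ^ (-1 - s) with hA
  have hAint : ∀ ξ, Integrable (fun t ↦ A t ξ) (volume.restrict (Ioi 0)) := fun ξ ↦
    integrableOn_one_sub_exp_neg_mul_rpow hs0 hs1 (by positivity)
  have hAmul : ∀ ξ, Integrable (fun t ↦ (A t ξ : ℂ) * h ξ) (volume.restrict (Ioi 0)) := by
    intro ξ
    have h1 : Integrable (fun t ↦ (A t ξ : ℂ)) (volume.restrict (Ioi 0)) := (hAint ξ).ofReal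
    exact h1.mul_const (h ξ)
  have hAnorm : ∀ ξ : 𝔼, EqOn (fun t ↦ ‖A t ξ‖) (fun t ↦ A t ξ) (Ioi 0) := fun ξ t ht ↦
    norm_of_nonneg (one_sub_exp_neg_mul_rpow_nonneg s (sq_nonneg _) ht)
  have hsymbA : ∀ ξ : 𝔼, (((2 * π * ‖ξ‖) ^ (2 * s) : ℝ) : ℂ) * h ξ =
      (J : ℂ)⁻¹ * ∫ t in Ioi (0 : ℝ), (A t ξ : ℂ) * h ξ := by
    intro ξ
    rw [symbol_eq_integral hs0 hs1, integral_mul_const, integral_complex_ofReal]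
    push_cast
    ring
  have hmeasA : Measurable fun q : 𝔼 × ℝ ↦ A q.2 q.1 := by
    simp only [hA]; fun_prop
  -- As `A ≥ 0`, integrating the norm in time gives back `J` times the symbol times `‖h ξ‖`, which
  -- is integrable by `hsymb`.
  have hprod : Integrable (fun q : 𝔼 × ℝ ↦ (A q.2 q.1 : ℂ) * h q.1)
      (volume.prod (volume.restrict (Ioi 0))) := by
    refine (integrable_prod_iff ?_).2 ⟨ae_of_all _ hAmul, ?_⟩
    · exact (Complex.measurable_ofReal.comp hmeasA).aestronglyMeasurable.mul
        (hcont.comp continuous_fst).aestronglyMeasurable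
    · refine (hsymb.norm.const_mul J).congr (ae_of_all _ fun ξ ↦ ?_)
      simp only [norm_mul, Complex.norm_real]
      rw [integral_mul_const, setIntegral_congr_fun measurableSet_Ioi (hAnorm ξ),
        norm_of_nonneg (by positivity), symbol_eq_integral hs0 hs1, ← hJ]
      simp only [hA, hh, norm_mul]
      rw [← mul_assoc, ← mul_assoc, ← mul_assoc, mul_inv_cancel₀ hJ0, one_mul, mul_assoc]
  -- The term `1` of `A` disappears by `hzero`; only the heat kernel survives, with a minus sign.
  have hinner : ∀ t ∈ Ioi (0 : ℝ), ∫ ξ, (A t ξ : ℂ) * h ξ =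
      -∫ p : 𝔼 × 𝔼, ((t ^ (-1 - s) * heatKernel d t ‖p.2 - p.1‖ : ℝ) : ℂ) *
        (v p.1 * ψ p.2) := by
    intro t ht
    have hgauss : Integrable fun ξ ↦ ((exp (-(t * (2 * π * ‖ξ‖) ^ 2)) : ℝ) : ℂ) * h ξ := by
      refine hint.bdd_mul (c := 1) (Continuous.aestronglyMeasurable (by fun_prop))
        (ae_of_all _ fun ξ ↦ ?_)
      rw [Complex.norm_real, norm_of_nonneg (exp_nonneg _)]
      have : 0 ≤ t * (2 * π * ‖ξ‖) ^ 2 := mul_nonneg (le_of_lt ht) (by positivity)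
      exact exp_le_one_iff.2 (by linarith)
    calc ∫ ξ, (A t ξ : ℂ) * h ξ
        = ∫ ξ, ((t ^ (-1 - s) : ℝ) : ℂ) *
          (h ξ - ((exp (-(t * (2 * π * ‖ξ‖) ^ 2)) : ℝ) : ℂ) * h ξ) := by
          congr 1; ext ξ; simp only [hA]; push_cast; ring
      _ = _ := by
          rw [integral_const_mul, integral_sub hint hgauss, hzero, zero_sub,
            integral_gaussian_mul_eq_integral_prod ht hv hψ, mul_neg, ← integral_const_mul]
          congr 2; ext p; push_cast; ring
  calc ∫ ξ, (((2 * π * ‖ξ‖) ^ (2 * s) : ℝ) : ℂ) * h ξ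
      = (J : ℂ)⁻¹ * ∫ ξ, ∫ t in Ioi (0 : ℝ), (A t ξ : ℂ) * h ξ := by
        simp_rw [hsymbA]; rw [integral_const_mul]
    _ = (J : ℂ)⁻¹ * ∫ t in Ioi (0 : ℝ), ∫ ξ, (A t ξ : ℂ) * h ξ := by
        rw [integral_integral_swap hprod]
    _ = (J : ℂ)⁻¹ * -∫ t in Ioi (0 : ℝ), ∫ p : 𝔼 × 𝔼,
          ((t ^ (-1 - s) * heatKernel d t ‖p.2 - p.1‖ : ℝ) : ℂ) * (v p.1 * ψ p.2) := by
        rw [setIntegral_congr_fun measurableSet_Ioi hinner, integral_neg]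
    _ = (J : ℂ)⁻¹ * -∫ p : 𝔼 × 𝔼, ∫ t in Ioi (0 : ℝ),
          ((t ^ (-1 - s) * heatKernel d t ‖p.2 - p.1‖ : ℝ) : ℂ) * (v p.1 * ψ p.2) := by
        rw [integral_integral_swap (integrable_rpow_mul_heatKernel_prod hs0 hδ hv hψ hsep)]
    _ = _ := by
        rw [mul_neg, ← integral_const_mul]
        congr 2; ext p
        rw [integral_mul_const, integral_complex_ofReal, jumpKernel]
        push_cast
        ring

/-! ### The symbol on test functions, and `fracLaplacian` as a functional on `L²`. -/

section

lemma conj_fourierInv (g : 𝔼 → ℂ) (x : 𝔼) :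
    conj (𝓕⁻ g x) = 𝓕 (fun ξ ↦ conj (g ξ)) x := by
  rw [fourierInv_eq', fourier_eq', ← integral_conj]
  congr 1; ext ξ
  simp only [smul_eq_mul, map_mul, ← Complex.exp_conj, Complex.conj_I, Complex.conj_ofReal]
  congr 2
  push_cast
  ring

lemma conj_fourierInv_ofReal (ψ : 𝔼 → ℝ) (ξ : 𝔼) :
    conj (𝓕⁻ (fun x ↦ (ψ x : ℂ)) ξ) = 𝓕 (fun x ↦ (ψ x : ℂ)) ξ := by
  simp only [conj_fourierInv, Complex.conj_ofReal]

lemma fourierInv_ofReal_eq_conj (ψ : 𝔼 → ℝ) (ξ : 𝔼) :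
    𝓕⁻ (fun x ↦ (ψ x : ℂ)) ξ = conj (𝓕 (fun x ↦ (ψ x : ℂ)) ξ) := by
  rw [← conj_fourierInv_ofReal, Complex.conj_conj]

/-- The Fourier symbol of `(-Δ)^s`. -/
def fracSymbol (s : ℝ) (ξ : 𝔼) : ℝ := (2 * π * ‖ξ‖) ^ (2 * s)

lemma fracSymbol_nonneg (s : ℝ) (ξ : 𝔼) : 0 ≤ fracSymbol s ξ := by
  unfold fracSymbol; positivity

lemma continuous_fracSymbol {s : ℝ} (hs0 : 0 < s) : Continuous (fracSymbol s : 𝔼 → ℝ) := by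
  unfold fracSymbol
  exact Continuous.rpow_const (by fun_prop) fun _ ↦ Or.inr (by positivity)

lemma fracSymbol_neg (s : ℝ) (ξ : 𝔼) : fracSymbol s (-ξ) = fracSymbol s ξ := by
  simp [fracSymbol]

/-- The symbol need not be smooth at the origin, so multiplication by it need not preserve Schwartz
functions; this polynomial majorant does preserve them. -/
lemma fracSymbol_le {s : ℝ} (hs0 : 0 < s) (hs1 : s < 1) (ξ : 𝔼) :
    fracSymbol s ξ ≤ 1 + (2 * π) ^ 2 * ‖ξ‖ ^ 2 := by
  unfold fracSymbol
  have h0 : 0 ≤ 2 * π * ‖ξ‖ := by positivity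
  rw [← mul_pow]
  rcases le_total (2 * π * ‖ξ‖) 1 with h | h
  · have := Real.rpow_le_one h0 h (show 0 ≤ 2 * s by positivity)
    nlinarith [sq_nonneg (2 * π * ‖ξ‖)]
  · have := Real.rpow_le_rpow_of_exponent_le h (show 2 * s ≤ 2 by linarith)
    rw [Real.rpow_two] at this
    linarith

/-- The symbol of `(-Δ)^s` maps Schwartz functions to all Lebesgue spaces. -/
lemma memLp_fracSymbol_mul {s : ℝ} (hs0 : 0 < s) (hs1 : s < 1) (f : 𝓢(𝔼, ℂ)) (p : ℝ≥0∞) :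
    MemLp (fun ξ ↦ (fracSymbol s ξ : ℂ) * f ξ) p := by
  have hg : (fun ξ : 𝔼 ↦ 1 + (2 * π) ^ 2 * ‖ξ‖ ^ 2).HasTemperateGrowth :=
    (Function.HasTemperateGrowth.const (1 : ℝ)).add
      ((Function.HasTemperateGrowth.const ((2 * π) ^ 2 : ℝ)).mul
        (Function.hasTemperateGrowth_norm_sq 𝔼))
  refine ((SchwartzMap.smulLeftCLM ℂ (fun ξ : 𝔼 ↦ 1 + (2 * π) ^ 2 * ‖ξ‖ ^ 2) f).memLp p
    volume).mono
    (Continuous.aestronglyMeasurable ?_) (ae_of_all _ fun ξ ↦ ?_)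
  · exact (Complex.continuous_ofReal.comp (continuous_fracSymbol hs0)).mul f.continuous
  · rw [SchwartzMap.smulLeftCLM_apply_apply hg, norm_mul, norm_smul, Complex.norm_real,
      norm_of_nonneg (fracSymbol_nonneg s ξ), norm_of_nonneg (by positivity)]
    exact mul_le_mul_of_nonneg_right (fracSymbol_le hs0 hs1 ξ) (norm_nonneg _)

variable {U : Set (EuclideanSpace ℝ (Fin d))} {ψ : EuclideanSpace ℝ (Fin d) → ℝ}

/-- A test function as a complex valued Schwartz function. -/
def IsTestFunction.toSchwartz (hψ : IsTestFunction U ψ) : 𝓢(𝔼, ℂ) :=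
  (hψ.2.1.comp_left (g := ((↑) : ℝ → ℂ)) Complex.ofReal_zero).toSchwartzMap
    (Complex.ofRealCLM.contDiff.comp hψ.1)

lemma IsTestFunction.coe_toSchwartz (hψ : IsTestFunction U ψ) :
    (hψ.toSchwartz : 𝔼 → ℂ) = fun x ↦ (ψ x : ℂ) := rfl

lemma IsTestFunction.fourier_toSchwartz (hψ : IsTestFunction U ψ) :
    ((𝓕 hψ.toSchwartz : 𝓢(𝔼, ℂ)) : 𝔼 → ℂ) = 𝓕 (fun x ↦ (ψ x : ℂ)) :=
  SchwartzMap.fourier_coe _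

lemma IsTestFunction.fourierInv_toSchwartz (hψ : IsTestFunction U ψ) :
    ((𝓕⁻ hψ.toSchwartz : 𝓢(𝔼, ℂ)) : 𝔼 → ℂ) = 𝓕⁻ (fun x ↦ (ψ x : ℂ)) :=
  SchwartzMap.fourierInv_coe _

lemma IsTestFunction.memLp_fracSymbol_mul_fourier (hψ : IsTestFunction U ψ) {s : ℝ}
    (hs0 : 0 < s) (hs1 : s < 1) (p : ℝ≥0∞) :
    MemLp (fun ξ ↦ (fracSymbol s ξ : ℂ) * 𝓕 (fun x ↦ (ψ x : ℂ)) ξ) p := by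
  rw [← hψ.fourier_toSchwartz]; exact memLp_fracSymbol_mul hs0 hs1 _ p

lemma IsTestFunction.memLp_fourier (hψ : IsTestFunction U ψ) (p : ℝ≥0∞) :
    MemLp (𝓕 (fun x ↦ (ψ x : ℂ))) p := by
  rw [← hψ.fourier_toSchwartz]; exact SchwartzMap.memLp (μ := volume) _ p

lemma IsTestFunction.memLp_fourierInv (hψ : IsTestFunction U ψ) (p : ℝ≥0∞) :
    MemLp (𝓕⁻ (fun x ↦ (ψ x : ℂ))) p := by
  rw [← hψ.fourierInv_toSchwartz]; exact SchwartzMap.memLp (μ := volume) _ p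

lemma IsTestFunction.integrable_ofReal (hψ : IsTestFunction U ψ) :
    Integrable (fun x ↦ (ψ x : ℂ)) :=
  hψ.toSchwartz.integrable

lemma complexify_ae (u : Lp ℝ 2 (volume : Measure 𝔼)) :
    complexify u =ᵐ[volume] fun x ↦ (u x : ℂ) :=
  Complex.ofRealCLM.coeFn_compLp' u

lemma complexify_eq_compLpL (u : Lp ℝ 2 (volume : Measure 𝔼)) :
    complexify u = Complex.ofRealCLM.compLpL 2 volume u := rfl

lemma complexify_add (u v : Lp ℝ 2 (volume : Measure 𝔼)) :
    complexify (u + v) = complexify u + complexify v := by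
  simp only [complexify_eq_compLpL, map_add]

lemma continuous_complexify : Continuous (complexify : Lp ℝ 2 (volume : Measure 𝔼) → _) :=
  (Complex.ofRealCLM.compLpL 2 (volume : Measure 𝔼)).continuous

lemma norm_complexify (u : Lp ℝ 2 (volume : Measure 𝔼)) : ‖complexify u‖ = ‖u‖ := by
  rw [Lp.norm_def, Lp.norm_def, eLpNorm_congr_norm_ae (g := u)]
  filter_upwards [complexify_ae u] with x hx
  rw [hx, Complex.norm_real]

lemma norm_fourier_complexify (u : Lp ℝ 2 (volume : Measure 𝔼)) :
    ‖𝓕 (complexify u)‖ = ‖u‖ := by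
  rw [Lp.norm_fourier_eq, norm_complexify]

lemma IsTestFunction.complexify_eq (hψ : IsTestFunction U ψ)
    {v : Lp ℝ 2 (volume : Measure 𝔼)} (hv : v =ᵐ[volume] ψ) :
    complexify v = hψ.toSchwartz.toLp 2 := by
  refine Lp.ext ?_
  filter_upwards [complexify_ae v, hv, hψ.toSchwartz.coeFn_toLp 2] with x h1 h2 h3
  rw [h1, h2, h3, hψ.coe_toSchwartz]

lemma IsTestFunction.fourier_complexify_ae (hψ : IsTestFunction U ψ)
    {v : Lp ℝ 2 (volume : Measure 𝔼)} (hv : v =ᵐ[volume] ψ) :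
    (𝓕 (complexify v) : Lp ℂ 2 (volume : Measure 𝔼)) =ᵐ[volume] 𝓕 (fun x ↦ (ψ x : ℂ)) := by
  rw [hψ.complexify_eq hv, SchwartzMap.toLp_fourier_eq, ← hψ.fourier_toSchwartz]
  exact SchwartzMap.coeFn_toLp _ 2 volume

/-- The Fourier transform of `(-Δ)^s ψ` for a test function `ψ`, as a square integrable
function. -/
def IsTestFunction.fourierFracLaplacian (hψ : IsTestFunction U ψ) {s : ℝ} (hs0 : 0 < s)
    (hs1 : s < 1) : Lp ℂ 2 (volume : Measure 𝔼) :=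
  (hψ.memLp_fracSymbol_mul_fourier hs0 hs1 2).toLp _

/-- With the symbol placed on `ψ`, linearity and `L²` continuity in `u` follow without any Sobolev
regularity of `u`. -/
lemma IsTestFunction.fracLaplacian_eq_inner (hψ : IsTestFunction U ψ) {s : ℝ} (hs0 : 0 < s)
    (hs1 : s < 1) (u : Lp ℝ 2 (volume : Measure 𝔼)) :
    fracLaplacian s u ψ = inner ℂ (hψ.fourierFracLaplacian hs0 hs1) (𝓕 (complexify u)) := by
  rw [L2.inner_def, fracLaplacian]
  refine integral_congr_ae ?_
  filter_upwards [(hψ.memLp_fracSymbol_mul_fourier hs0 hs1 2).coeFn_toLp] with ξ hξ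
  rw [IsTestFunction.fourierFracLaplacian, hξ, RCLike.inner_apply, map_mul, Complex.conj_ofReal,
    ← fourierInv_ofReal_eq_conj, fracSymbol]
  ring

lemma IsTestFunction.fracLaplacian_add (hψ : IsTestFunction U ψ) {s : ℝ} (hs0 : 0 < s)
    (hs1 : s < 1) (u v : Lp ℝ 2 (volume : Measure 𝔼)) :
    fracLaplacian s (u + v) ψ = fracLaplacian s u ψ + fracLaplacian s v ψ := by
  simp only [hψ.fracLaplacian_eq_inner hs0 hs1, complexify_add, FourierTransform.fourier_add,
    inner_add_right]

lemma IsTestFunction.continuous_fracLaplacian (hψ : IsTestFunction U ψ) {s : ℝ} (hs0 : 0 < s)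
    (hs1 : s < 1) :
    Continuous fun u : Lp ℝ 2 (volume : Measure 𝔼) ↦ fracLaplacian s u ψ := by
  simp only [hψ.fracLaplacian_eq_inner hs0 hs1]
  exact continuous_const.inner ((Lp.fourierTransformₗᵢ 𝔼 ℂ).continuous.comp continuous_complexify)

end

/-! ### Approximation in `H̃^s(Ω)` and the kernel formula away from `Ω`. -/

section

lemma enorm_sq_eq_lintegral_fourier (z : Lp ℝ 2 (volume : Measure 𝔼)) :
    ‖z‖ₑ ^ 2 = ∫⁻ ξ, ‖𝓕 (complexify z) ξ‖ₑ ^ 2 := by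
  have h := eLpNorm_nnreal_pow_eq_lintegral (μ := (volume : Measure 𝔼)) (p := 2)
    (f := (𝓕 (complexify z) : Lp ℂ 2 (volume : Measure 𝔼))) (by norm_num)
  have h2 : ‖(𝓕 (complexify z) : Lp ℂ 2 (volume : Measure 𝔼))‖ₑ = ‖z‖ₑ := by
    rw [← ofReal_norm, ← ofReal_norm, norm_fourier_complexify]
  rw [← h2, Lp.enorm_def]
  simp only [NNReal.coe_ofNat, ENNReal.coe_ofNat, ENNReal.rpow_two] at h
  exact h

lemma enorm_sq_le_sobolevNormSq {s : ℝ} (hs0 : 0 < s) (z : Lp ℝ 2 (volume : Measure 𝔼)) :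
    ‖z‖ₑ ^ 2 ≤ sobolevNormSq s z := by
  rw [enorm_sq_eq_lintegral_fourier, sobolevNormSq]
  refine lintegral_mono fun ξ ↦ ?_
  refine le_mul_of_one_le_left zero_le ?_
  rw [← ENNReal.ofReal_one]
  exact ENNReal.ofReal_le_ofReal (Real.one_le_rpow (by nlinarith [sq_nonneg ‖ξ‖]) hs0.le)

variable {s : ℝ} {Ω : Set (EuclideanSpace ℝ (Fin d))}
  {w : Lp ℝ 2 (volume : Measure (EuclideanSpace ℝ (Fin d)))}

lemma MemHTilde.exists_seq (hw : MemHTilde s Ω w) :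
    ∃ (χ : ℕ → 𝔼 → ℝ) (v : ℕ → Lp ℝ 2 (volume : Measure 𝔼)),
      (∀ n, IsTestFunction Ω (χ n)) ∧ (∀ n, v n =ᵐ[volume] χ n) ∧
      Tendsto (fun n ↦ sobolevNormSq s (w - v n)) atTop (𝓝 0) := by
  have h : ∀ n : ℕ, ∃ (ψ : 𝔼 → ℝ) (v : Lp ℝ 2 (volume : Measure 𝔼)),
      IsTestFunction Ω ψ ∧ v =ᵐ[volume] ψ ∧ sobolevNormSq s (w - v) < (n : ℝ≥0∞)⁻¹ :=
    fun n ↦ hw.2 _ (by simp)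
  choose χ v h1 h2 h3 using h
  exact ⟨χ, v, h1, h2, tendsto_of_tendsto_of_tendsto_of_le_of_le tendsto_const_nhds
    ENNReal.tendsto_inv_nat_nhds_zero (fun _ ↦ zero_le) fun n ↦ (h3 n).le⟩

lemma tendsto_of_tendsto_sobolevNormSq (hs0 : 0 < s) {v : ℕ → Lp ℝ 2 (volume : Measure 𝔼)}
    (h : Tendsto (fun n ↦ sobolevNormSq s (w - v n)) atTop (𝓝 0)) :
    Tendsto v atTop (𝓝 w) := by
  rw [tendsto_iff_norm_sub_tendsto_zero]
  have h1 : Tendsto (fun n ↦ ‖w - v n‖ₑ ^ 2) atTop (𝓝 0) :=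
    tendsto_of_tendsto_of_tendsto_of_le_of_le tendsto_const_nhds h (fun _ ↦ zero_le)
      fun n ↦ enorm_sq_le_sobolevNormSq hs0 _
  have h2 := ((ENNReal.tendsto_toReal ENNReal.zero_ne_top).comp h1).sqrt
  simp only [ENNReal.toReal_zero, sqrt_zero] at h2
  refine h2.congr fun n ↦ ?_
  simp only [Function.comp_apply, ENNReal.toReal_pow, toReal_enorm]
  rw [sqrt_sq (norm_nonneg _), norm_sub_rev]

lemma IsTestFunction.eq_zero_of_notMem {U : Set 𝔼} {ψ : 𝔼 → ℝ} (hψ : IsTestFunction U ψ) {x : 𝔼}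
    (hx : x ∉ U) : ψ x = 0 :=
  image_eq_zero_of_notMem_tsupport fun h ↦ hx (hψ.2.2 h)

lemma integrableOn_of_L2 (hΩ : volume Ω ≠ ⊤) (w : Lp ℝ 2 (volume : Measure 𝔼)) :
    IntegrableOn w Ω := by
  have : IsFiniteMeasure (volume.restrict Ω) := isFiniteMeasure_restrict.2 hΩ
  exact ((Lp.memLp w).restrict Ω).integrable (by norm_num)

lemma setIntegral_norm_le_sqrt_mul_norm (hΩ : volume Ω ≠ ⊤) (w : Lp ℝ 2 (volume : Measure 𝔼)) :
    ∫ x in Ω, ‖w x‖ ≤ √(volume Ω).toReal * ‖w‖ := by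
  have h := eLpNorm_le_eLpNorm_mul_rpow_measure_univ (p := 1) (q := 2)
    (μ := volume.restrict Ω) (by norm_num) (Lp.aestronglyMeasurable w).restrict
  have h2 : eLpNorm w 2 (volume.restrict Ω) ≤ ‖w‖ₑ := by
    rw [Lp.enorm_def]; exact eLpNorm_mono_measure _ Measure.restrict_le_self
  have h3 : eLpNorm w 1 (volume.restrict Ω) ≤ ‖w‖ₑ * volume Ω ^ ((1 : ℝ) / 2) := by
    refine h.trans ?_
    rw [Measure.restrict_apply_univ]
    norm_num
    gcongr
  have h4 := ENNReal.toReal_mono (ENNReal.mul_ne_top enorm_ne_top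
    (ENNReal.rpow_ne_top_of_nonneg (by norm_num) hΩ)) h3
  rw [eLpNorm_one_eq_lintegral_enorm, ENNReal.toReal_mul, toReal_enorm, ← ENNReal.toReal_rpow,
    ← Real.sqrt_eq_rpow, mul_comm,
    ← integral_norm_eq_lintegral_enorm (Lp.aestronglyMeasurable w).restrict] at h4
  exact h4

variable {D : Set (EuclideanSpace ℝ (Fin d))} {δ : ℝ} {χ ψ : EuclideanSpace ℝ (Fin d) → ℝ}

/-- The bilinear form given by the jump kernel. -/
def jumpForm (s : ℝ) (v ψ : 𝔼 → ℝ) : ℝ :=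
  ∫ p : 𝔼 × 𝔼, v p.1 * ψ p.2 * jumpKernel d s ‖p.2 - p.1‖

lemma separatedBy_ofReal (hsep : ∀ y ∈ Ω, ∀ x ∈ D, δ ≤ ‖x - y‖) {v ψ : 𝔼 → ℝ}
    (hv : ∀ x ∉ Ω, v x = 0) (hψ : ∀ x ∉ D, ψ x = 0) :
    SeparatedBy δ (fun x ↦ (v x : ℂ)) (fun x ↦ (ψ x : ℂ)) := by
  intro y x hy hx
  refine hsep y ?_ x ?_
  · by_contra h; exact hy (by simp [hv y h])
  · by_contra h; exact hx (by simp [hψ x h])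

lemma integrable_jumpForm (hs0 : 0 < s) (hs1 : s < 1) (hδ : 0 < δ)
    (hsep : ∀ y ∈ Ω, ∀ x ∈ D, δ ≤ ‖x - y‖) {v ψ : 𝔼 → ℝ} (hv : Integrable v) (hψ : Integrable ψ)
    (hv0 : ∀ x ∉ Ω, v x = 0) (hψ0 : ∀ x ∉ D, ψ x = 0) :
    Integrable (fun p : 𝔼 × 𝔼 ↦ v p.1 * ψ p.2 * jumpKernel d s ‖p.2 - p.1‖) := by
  have h := integrable_mul_mul_jumpKernel hs0 hs1 hδ hv.ofReal hψ.ofReal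
    (separatedBy_ofReal hsep hv0 hψ0)
  simpa using! h.re

lemma abs_jumpForm_le (hs0 : 0 < s) (hs1 : s < 1) (hδ : 0 < δ)
    (hsep : ∀ y ∈ Ω, ∀ x ∈ D, δ ≤ ‖x - y‖) {v ψ : 𝔼 → ℝ} (hv : Integrable v) (hψ : Integrable ψ)
    (hv0 : ∀ x ∉ Ω, v x = 0) (hψ0 : ∀ x ∉ D, ψ x = 0) :
    |jumpForm s v ψ| ≤ jumpKernel d s δ * ((∫ y, ‖v y‖) * ∫ x, ‖ψ x‖) := by
  rw [← integral_prod_mul, ← integral_const_mul, jumpForm, ← Real.norm_eq_abs]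
  refine norm_integral_le_of_norm_le ((hv.norm.mul_prod hψ.norm).const_mul _)
    (ae_of_all _ fun p ↦ ?_)
  have := norm_mul_mul_jumpKernel_le hs0 hs1 hδ (separatedBy_ofReal hsep hv0 hψ0) p.1 p.2
  simpa using! this

lemma IsTestFunction.integrable (hψ : IsTestFunction D ψ) : Integrable ψ :=
  hψ.1.continuous.integrable_of_hasCompactSupport hψ.2.1

lemma fracLaplacian_eq_neg_jumpForm_of_test (hs0 : 0 < s) (hs1 : s < 1) (hδ : 0 < δ)
    (hsep : ∀ y ∈ Ω, ∀ x ∈ D, δ ≤ ‖x - y‖) (hχ : IsTestFunction Ω χ) (hψ : IsTestFunction D ψ)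
    {v : Lp ℝ 2 (volume : Measure 𝔼)} (hv : v =ᵐ[volume] χ) :
    fracLaplacian s v ψ = ((-jumpForm s χ ψ : ℝ) : ℂ) := by
  have hsep' := separatedBy_ofReal hsep (fun _ ↦ hχ.eq_zero_of_notMem)
    (fun _ ↦ hψ.eq_zero_of_notMem)
  -- By Parseval this is `∫ χ ψ`; a point where both factors are nonzero would give `δ ≤ ‖x - x‖ =
  -- 0`.
  have hzero : ∫ ξ, 𝓕 (fun x ↦ (χ x : ℂ)) ξ * 𝓕⁻ (fun x ↦ (ψ x : ℂ)) ξ = 0 := by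
    rw [← hχ.fourier_toSchwartz, ← hψ.fourierInv_toSchwartz, SchwartzMap.integral_fourier_mul_eq,
      FourierTransform.fourier_fourierInv_eq]
    rw [integral_eq_zero_of_ae (ae_of_all _ fun x ↦ ?_)]
    by_contra h
    have h1 := left_ne_zero_of_mul h
    have h2 := right_ne_zero_of_mul h
    have := hsep' x x h1 h2
    simp at this
    linarith
  have h := integral_symbol_mul_fourier_mul_fourierInv hs0 hs1 hδ hχ.integrable_ofReal
    hψ.integrable_ofReal hsep' ((hχ.memLp_fourier 2).integrable_mul (hψ.memLp_fourierInv 2)) ?_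
    hzero
  · calc fracLaplacian s v ψ = _ := by
          refine integral_congr_ae ?_
          filter_upwards [hχ.fourier_complexify_ae hv] with ξ hξ
          rw [hξ, mul_assoc]
      _ = _ := h
      _ = _ := by
          rw [jumpForm, Complex.ofReal_neg, ← integral_complex_ofReal]
          push_cast
          rfl
  · refine ((hχ.memLp_fracSymbol_mul_fourier hs0 hs1 2).integrable_mul
      (hψ.memLp_fourierInv 2)).congr (ae_of_all _ fun ξ ↦ ?_)
    simp only [Pi.mul_apply, fracSymbol]
    ring

/-- The restriction of `(-Δ)^s w` to a set separated from `Ω` is given by the jump kernel, for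
every `w ∈ H̃^s(Ω)`. -/
lemma MemHTilde.fracLaplacian_eq_neg_jumpForm (hs0 : 0 < s) (hs1 : s < 1) (hδ : 0 < δ)
    (hΩ : MeasurableSet Ω) (hΩfin : volume Ω ≠ ⊤)
    (hsep : ∀ y ∈ Ω, ∀ x ∈ D, δ ≤ ‖x - y‖) (hw : MemHTilde s Ω w) (hψ : IsTestFunction D ψ) :
    fracLaplacian s w ψ = ((-jumpForm s (Ω.indicator w) ψ : ℝ) : ℂ) := by
  obtain ⟨χ, v, hχ, hv, hlim⟩ := hw.exists_seq
  have hvw := tendsto_of_tendsto_sobolevNormSq hs0 hlim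
  have h1 : Tendsto (fun n ↦ fracLaplacian s (v n) ψ) atTop (𝓝 (fracLaplacian s w ψ)) :=
    ((hψ.continuous_fracLaplacian hs0 hs1).tendsto w).comp hvw
  have hind : Integrable (Ω.indicator w) :=
    (integrable_indicator_iff hΩ).2 (integrableOn_of_L2 hΩfin w)
  have hind0 : ∀ x ∉ Ω, Ω.indicator w x = 0 := fun x hx ↦ indicator_of_notMem hx _
  have hψ0 : ∀ x ∉ D, ψ x = 0 := fun x hx ↦ hψ.eq_zero_of_notMem hx
  -- The form is continuous for the `L¹(Ω)` norm, hence for the `L²` norm since `Ω` has finite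
  -- measure. Thanks to the indicator, `w = 0` outside `Ω` need not be known.
  have hbound : ∀ n, ‖fracLaplacian s (v n) ψ - ((-jumpForm s (Ω.indicator w) ψ : ℝ) : ℂ)‖ ≤
      jumpKernel d s δ * ((√(volume Ω).toReal * ‖w - v n‖) * ∫ x, ‖ψ x‖) := by
    intro n
    have hχ0 : ∀ x ∉ Ω, χ n x = 0 := fun x hx ↦ (hχ n).eq_zero_of_notMem hx
    have hsub : jumpForm s (Ω.indicator w) ψ - jumpForm s (χ n) ψ =
        jumpForm s (fun x ↦ Ω.indicator w x - χ n x) ψ := by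
      rw [jumpForm, jumpForm, ← integral_sub
        (integrable_jumpForm hs0 hs1 hδ hsep hind hψ.integrable hind0 hψ0)
        (integrable_jumpForm hs0 hs1 hδ hsep (hχ n).integrable hψ.integrable hχ0 hψ0), jumpForm]
      congr 1; ext p; ring
    have hL1 : ∫ y, ‖Ω.indicator w y - χ n y‖ ≤ √(volume Ω).toReal * ‖w - v n‖ := by
      refine le_trans (le_of_eq ?_) (setIntegral_norm_le_sqrt_mul_norm hΩfin (w - v n))
      rw [← integral_indicator hΩ]
      refine integral_congr_ae ?_
      filter_upwards [Lp.coeFn_sub w (v n), hv n] with x h1 h2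
      by_cases hx : x ∈ Ω
      · rw [indicator_of_mem hx, indicator_of_mem hx, h1, Pi.sub_apply, h2]
      · simp [hx, hχ0 x hx]
    rw [fracLaplacian_eq_neg_jumpForm_of_test hs0 hs1 hδ hsep (hχ n) hψ (hv n),
      ← Complex.ofReal_sub, Complex.norm_real, neg_sub_neg, hsub, Real.norm_eq_abs]
    refine (abs_jumpForm_le hs0 hs1 hδ hsep (hind.sub (hχ n).integrable) hψ.integrable
      (fun x hx ↦ by simp [hx, hχ0 x hx]) hψ0).trans ?_
    exact mul_le_mul_of_nonneg_left (mul_le_mul_of_nonneg_right hL1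
      (integral_nonneg fun _ ↦ norm_nonneg _)) (jumpKernel_nonneg hs0 hs1 δ)
  have h2 : Tendsto (fun n ↦ fracLaplacian s (v n) ψ) atTop
      (𝓝 ((-jumpForm s (Ω.indicator w) ψ : ℝ) : ℂ)) := by
    rw [tendsto_iff_norm_sub_tendsto_zero]
    refine squeeze_zero (fun _ ↦ norm_nonneg _) hbound ?_
    have h3 : Tendsto (fun n ↦ ‖w - v n‖) atTop (𝓝 0) := by
      have := (hvw.const_sub w).norm
      simpa using this
    have h4 := ((h3.const_mul √(volume Ω).toReal).mul_const (∫ x, ‖ψ x‖)).const_mul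
      (jumpKernel d s δ)
    simpa using h4
  exact tendsto_nhds_unique h1 h2

end

/-! ### Energy estimates and the Poincaré inequality. -/

section

variable {s : ℝ} {Ω U : Set (EuclideanSpace ℝ (Fin d))}
  {w : Lp ℝ 2 (volume : Measure (EuclideanSpace ℝ (Fin d)))}
  {φ χ : EuclideanSpace ℝ (Fin d) → ℝ}

lemma norm_sq_eq_integral_fourier (z : Lp ℝ 2 (volume : Measure 𝔼)) :
    ‖z‖ ^ 2 = ∫ ξ, ‖𝓕 (complexify z) ξ‖ ^ 2 := by
  have h := congrArg ENNReal.toReal (enorm_sq_eq_lintegral_fourier z)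
  rw [ENNReal.toReal_pow, toReal_enorm] at h
  rw [h, integral_eq_lintegral_of_nonneg_ae (ae_of_all _ fun _ ↦ sq_nonneg _)
    ((Lp.aestronglyMeasurable _).norm.pow 2)]
  simp only [ENNReal.ofReal_pow (norm_nonneg _), ofReal_norm]

/-- The quadratic form of `(-Δ)^s`. -/
def fracEnergy (s : ℝ) (χ : 𝔼 → ℝ) : ℝ :=
  ∫ ξ, fracSymbol s ξ * ‖𝓕 (fun x ↦ (χ x : ℂ)) ξ‖ ^ 2

lemma IsTestFunction.integrable_fracEnergy (hχ : IsTestFunction U χ) (hs0 : 0 < s) (hs1 : s < 1) :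
    Integrable fun ξ ↦ fracSymbol s ξ * ‖𝓕 (fun x ↦ (χ x : ℂ)) ξ‖ ^ 2 := by
  refine ((hχ.memLp_fracSymbol_mul_fourier hs0 hs1 2).integrable_mul
    (hχ.memLp_fourier 2)).norm.congr (ae_of_all _ fun ξ ↦ ?_)
  simp only [Pi.mul_apply, norm_mul, Complex.norm_real, norm_of_nonneg (fracSymbol_nonneg s ξ)]
  ring

lemma IsTestFunction.fracLaplacian_self (hχ : IsTestFunction U χ)
    {v : Lp ℝ 2 (volume : Measure 𝔼)} (hv : v =ᵐ[volume] χ) :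
    fracLaplacian s v χ = (fracEnergy s χ : ℂ) := by
  rw [fracEnergy, ← integral_complex_ofReal]
  refine integral_congr_ae ?_
  filter_upwards [hχ.fourier_complexify_ae hv] with ξ hξ
  rw [hξ, fourierInv_ofReal_eq_conj, mul_assoc, Complex.mul_conj, Complex.normSq_eq_norm_sq,
    fracSymbol]
  push_cast
  rfl

/-- By symmetry the operator moves from `χ` to `φ`, so only the `L²` norm of `χ` is paid, not its
energy. -/
lemma IsTestFunction.norm_fracLaplacian_le (hφ : IsTestFunction U φ) (hs0 : 0 < s) (hs1 : s < 1)
    {φ' v : Lp ℝ 2 (volume : Measure 𝔼)} (hφ' : φ' =ᵐ[volume] φ) (hχ : IsTestFunction Ω χ)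
    (hv : v =ᵐ[volume] χ) :
    ‖fracLaplacian s φ' χ‖ ≤
      (eLpNorm (fun ξ ↦ (fracSymbol s ξ : ℂ) * 𝓕 (fun x ↦ (φ x : ℂ)) ξ) 2 volume).toReal *
        ‖v‖ := by
  have hsymm : fracLaplacian s φ' χ = conj (fracLaplacian s v φ) := by
    rw [fracLaplacian, fracLaplacian, ← integral_conj]
    refine integral_congr_ae ?_
    filter_upwards [hχ.fourier_complexify_ae hv, hφ.fourier_complexify_ae hφ'] with ξ h1 h2
    rw [h1, h2, map_mul, map_mul, Complex.conj_ofReal, conj_fourierInv_ofReal,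
      fourierInv_ofReal_eq_conj]
    ring
  rw [hsymm, RCLike.norm_conj, hφ.fracLaplacian_eq_inner hs0 hs1]
  refine (norm_inner_le_norm _ _).trans ?_
  rw [norm_fourier_complexify, IsTestFunction.fourierFracLaplacian, Lp.norm_toLp]

lemma fracSymbol_le_mul_one_add_rpow (hs0 : 0 < s) (ξ : 𝔼) :
    fracSymbol s ξ ≤ (2 * π) ^ (2 * s) * (1 + ‖ξ‖ ^ 2) ^ s := by
  rw [fracSymbol, Real.mul_rpow (by positivity) (norm_nonneg _), Real.rpow_mul (norm_nonneg _),
    Real.rpow_two]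
  gcongr
  linarith

lemma integrable_fracSymbol_mul_norm_sq (hs0 : 0 < s) {z : Lp ℝ 2 (volume : Measure 𝔼)}
    (hz : sobolevNormSq s z ≠ ⊤) :
    Integrable (fun ξ ↦ fracSymbol s ξ * ‖𝓕 (complexify z) ξ‖ ^ 2) ∧
    ∫ ξ, fracSymbol s ξ * ‖𝓕 (complexify z) ξ‖ ^ 2 ≤
      (2 * π) ^ (2 * s) * (sobolevNormSq s z).toReal := by
  have hmeas : AEStronglyMeasurable (fun ξ ↦ fracSymbol s ξ * ‖𝓕 (complexify z) ξ‖ ^ 2)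
      volume :=
    (continuous_fracSymbol hs0).aestronglyMeasurable.mul ((Lp.aestronglyMeasurable _).norm.pow 2)
  have hle : ∫⁻ ξ, ENNReal.ofReal (fracSymbol s ξ * ‖𝓕 (complexify z) ξ‖ ^ 2) ≤
      ENNReal.ofReal ((2 * π) ^ (2 * s)) * sobolevNormSq s z := by
    rw [sobolevNormSq, ← lintegral_const_mul' _ _ ENNReal.ofReal_ne_top]
    refine lintegral_mono fun ξ ↦ ?_
    rw [ENNReal.ofReal_mul (fracSymbol_nonneg s ξ), ENNReal.ofReal_pow (norm_nonneg _),
      ofReal_norm, ← mul_assoc, ← ENNReal.ofReal_mul (by positivity)]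
    gcongr
    exact fracSymbol_le_mul_one_add_rpow hs0 ξ
  have hnn : 0 ≤ᵐ[volume] fun ξ ↦ fracSymbol s ξ * ‖𝓕 (complexify z) ξ‖ ^ 2 :=
    ae_of_all _ fun ξ ↦ mul_nonneg (fracSymbol_nonneg s ξ) (sq_nonneg _)
  have htop := ENNReal.mul_ne_top (ENNReal.ofReal_ne_top (r := (2 * π) ^ (2 * s))) hz
  refine ⟨⟨hmeas, ?_⟩, ?_⟩
  · rw [hasFiniteIntegral_iff_ofReal hnn]
    exact hle.trans_lt htop.lt_top
  · rw [integral_eq_lintegral_of_nonneg_ae hnn hmeas]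
    refine (ENNReal.toReal_mono htop hle).trans (le_of_eq ?_)
    rw [ENNReal.toReal_mul, ENNReal.toReal_ofReal (by positivity)]

/-- This is `2ab ≤ a² + b²` under the symbol; the factor `2` lets half of the energy of `χ` be
absorbed later. -/
lemma IsTestFunction.norm_fracLaplacian_le_add (hχ : IsTestFunction U χ) (hs0 : 0 < s)
    (hs1 : s < 1) {z : Lp ℝ 2 (volume : Measure 𝔼)} (hz : sobolevNormSq s z ≠ ⊤) :
    2 * ‖fracLaplacian s z χ‖ ≤
      (2 * π) ^ (2 * s) * (sobolevNormSq s z).toReal + fracEnergy s χ := by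
  obtain ⟨h1, h2⟩ := integrable_fracSymbol_mul_norm_sq hs0 hz
  have h3 := hχ.integrable_fracEnergy hs0 hs1
  refine le_trans ?_ (add_le_add_left h2 _)
  rw [fracEnergy, ← integral_add h1 h3]
  have h4 : ‖fracLaplacian s z χ‖ ≤ ∫ ξ, (1 / 2) * (fracSymbol s ξ * ‖𝓕 (complexify z) ξ‖ ^ 2 +
      fracSymbol s ξ * ‖𝓕 (fun x ↦ (χ x : ℂ)) ξ‖ ^ 2) := by
    refine norm_integral_le_of_norm_le ((h1.add h3).const_mul _) (ae_of_all _ fun ξ ↦ ?_)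
    have h0 := fracSymbol_nonneg s ξ
    rw [norm_mul, norm_mul, Complex.norm_real, ← fracSymbol, norm_of_nonneg h0,
      fourierInv_ofReal_eq_conj, RCLike.norm_conj]
    nlinarith [mul_nonneg h0
      (sq_nonneg (‖𝓕 (complexify z) ξ‖ - ‖𝓕 (fun x ↦ (χ x : ℂ)) ξ‖))]
  rw [integral_const_mul] at h4
  linarith

lemma setIntegral_norm_mul_norm_le (z v : Lp ℝ 2 (volume : Measure 𝔼)) :
    IntegrableOn (fun x ↦ ‖z x‖ * ‖v x‖) Ω ∧ ∫ x in Ω, ‖z x‖ * ‖v x‖ ≤ ‖z‖ * ‖v‖ := by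
  have hint : Integrable (fun x ↦ ‖z x‖ * ‖v x‖) :=
    (Lp.memLp z).norm.integrable_mul (Lp.memLp v).norm
  refine ⟨hint.integrableOn, ?_⟩
  refine (setIntegral_le_integral hint (ae_of_all _ fun x ↦ by positivity)).trans ?_
  have h := real_inner_le_norm |v| |z|
  rw [norm_abs_eq_norm, norm_abs_eq_norm, L2.inner_def] at h
  rw [mul_comm]
  refine le_trans (le_of_eq (integral_congr_ae ?_)) h
  filter_upwards [Lp.coeFn_abs z, Lp.coeFn_abs v] with x h1 h2
  rw [h1, h2]
  simp

/-- A radius for which the low frequencies of a function supported in a set of measure `m` carry at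
most half of its mass. -/
lemma exists_radius (hd : 1 ≤ d) (m : ℝ) (hm : 0 ≤ m) :
    ∃ R : ℝ, 0 < R ∧ (volume (Metric.ball (0 : 𝔼) R)).toReal * m ≤ 1 / 2 := by
  set V := (volume (Metric.ball (0 : 𝔼) 1)).toReal with hV
  have hV0 : 0 ≤ V := ENNReal.toReal_nonneg
  have hden : 0 < 2 * (m + 1) * (V + 1) := by positivity
  -- This radius is at most `1`, so `R ^ d ≤ R` for `d ≥ 1`, and a bound linear in `R` suffices in
  -- every dimension.
  refine ⟨(2 * (m + 1) * (V + 1))⁻¹, by positivity, ?_⟩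
  set R := (2 * (m + 1) * (V + 1))⁻¹ with hR
  have hR0 : 0 < R := by positivity
  have hR1 : R ≤ 1 := inv_le_one_of_one_le₀ (by nlinarith [mul_nonneg hm hV0])
  rw [Measure.addHaar_ball_of_pos _ _ hR0, finrank_euclideanSpace_fin, ENNReal.toReal_mul,
    ENNReal.toReal_ofReal (by positivity), ← hV]
  have h1 : R ^ d ≤ R := by
    calc R ^ d ≤ R ^ 1 := pow_le_pow_of_le_one hR0.le hR1 hd
      _ = R := pow_one R
  calc R ^ d * V * m ≤ R * V * m := by gcongr
    _ ≤ R * ((m + 1) * (V + 1)) := by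
      rw [mul_assoc]
      refine mul_le_mul_of_nonneg_left ?_ hR0.le
      nlinarith [mul_nonneg hm hV0]
    _ = 1 / 2 := by rw [hR]; field_simp

/-- The Poincaré inequality for `(-Δ)^s` on sets of given measure. -/
lemma exists_poincare_const (hd : 1 ≤ d) (hs0 : 0 < s) (hs1 : s < 1) (m : ℝ) (hm : 0 ≤ m) :
    ∃ P : ℝ, 0 ≤ P ∧ ∀ (Ω : Set 𝔼) (χ : 𝔼 → ℝ) (v : Lp ℝ 2 (volume : Measure 𝔼)),
      MeasurableSet Ω → volume Ω ≠ ⊤ → (volume Ω).toReal = m → IsTestFunction Ω χ →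
      v =ᵐ[volume] χ → ‖v‖ ^ 2 ≤ P * fracEnergy s χ := by
  obtain ⟨R, hR0, hR⟩ := exists_radius (d := d) hd m hm
  set c : ℝ := (2 * π * R) ^ (2 * s) with hc
  have hc0 : 0 < c := by positivity
  refine ⟨2 * c⁻¹, by positivity, fun Ω χ v hΩ hfin hvol hχ hv ↦ ?_⟩
  set F : 𝔼 → ℂ := 𝓕 (fun x ↦ (χ x : ℂ)) with hF
  have hA : ‖v‖ ^ 2 = ∫ ξ, ‖F ξ‖ ^ 2 := by
    rw [norm_sq_eq_integral_fourier]
    refine integral_congr_ae ?_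
    filter_upwards [hχ.fourier_complexify_ae hv] with ξ hξ
    rw [hξ]
  have hFint : Integrable fun ξ ↦ ‖F ξ‖ ^ 2 := by
    refine ((hχ.memLp_fourier 2).norm.integrable_mul (hχ.memLp_fourier 2).norm).congr
      (ae_of_all _ fun ξ ↦ ?_)
    simp only [Pi.mul_apply, hF, sq]
  have hL1 : ∫ x, ‖(χ x : ℂ)‖ ≤ √m * ‖v‖ := by
    rw [← hvol]
    refine le_trans (le_of_eq ?_) (setIntegral_norm_le_sqrt_mul_norm hfin v)
    rw [← integral_indicator hΩ]
    refine integral_congr_ae ?_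
    filter_upwards [hv] with x hx
    by_cases h : x ∈ Ω
    · rw [indicator_of_mem h, hx, Complex.norm_real]
    · rw [indicator_of_notMem h, hχ.eq_zero_of_notMem h]; simp
  have hbd : ∀ ξ, ‖F ξ‖ ^ 2 ≤ m * ‖v‖ ^ 2 := by
    intro ξ
    have h := pow_le_pow_left₀ (norm_nonneg _) ((norm_fourier_le_integral _ ξ).trans hL1) 2
    rwa [mul_pow, Real.sq_sqrt hm] at h
  -- Low frequencies are controlled by the sup bound `hbd`, high ones by `fracSymbol s ξ ≥ c`. After
  -- integration the ball carries at most `‖v‖ ^ 2 / 2`, which is absorbed on the left; hence the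
  -- constant `2 * c⁻¹`.
  have hpt : ∀ ξ, ‖F ξ‖ ^ 2 ≤ (Metric.ball (0 : 𝔼) R).indicator (fun _ ↦ m * ‖v‖ ^ 2) ξ +
      c⁻¹ * (fracSymbol s ξ * ‖F ξ‖ ^ 2) := by
    intro ξ
    have hσ := mul_nonneg (inv_nonneg.2 hc0.le)
      (mul_nonneg (fracSymbol_nonneg s ξ) (sq_nonneg ‖F ξ‖))
    by_cases h : ξ ∈ Metric.ball (0 : 𝔼) R
    · rw [indicator_of_mem h]; linarith [hbd ξ]
    · rw [indicator_of_notMem h, zero_add, ← mul_assoc]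
      refine le_mul_of_one_le_left (sq_nonneg _) ?_
      rw [inv_mul_eq_div, one_le_div hc0, hc, fracSymbol]
      have : R ≤ ‖ξ‖ := by simpa using h
      gcongr
  have hball : volume (Metric.ball (0 : 𝔼) R) ≠ ⊤ := measure_ball_lt_top.ne
  have hi1 : Integrable ((Metric.ball (0 : 𝔼) R).indicator fun _ ↦ m * ‖v‖ ^ 2) :=
    (integrable_indicator_iff measurableSet_ball).2 (integrableOn_const hball)
  have hi2 := (hχ.integrable_fracEnergy hs0 hs1).const_mul c⁻¹
  have hkey := integral_mono hFint (hi1.add hi2) hpt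
  simp only [Pi.add_apply] at hkey
  rw [integral_add hi1 hi2, integral_indicator measurableSet_ball, setIntegral_const,
    integral_const_mul, ← hA, smul_eq_mul, measureReal_def] at hkey
  have h2 : (volume (Metric.ball (0 : 𝔼) R)).toReal * (m * ‖v‖ ^ 2) ≤ 1 / 2 * ‖v‖ ^ 2 := by
    rw [← mul_assoc]
    exact mul_le_mul_of_nonneg_right hR (sq_nonneg _)
  have h3 : fracEnergy s χ = ∫ ξ, fracSymbol s ξ * ‖F ξ‖ ^ 2 := rfl
  rw [h3]
  linarith

/-- The energy inequality for an approximation `v` of `w = u - φ'`. -/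
lemma fracEnergy_le_of_equation (hs0 : 0 < s) (hs1 : s < 1) (hΩ : MeasurableSet Ω)
    {f : 𝔼 → ℝ} {B : ℝ} (hB0 : 0 ≤ B)
    (hfB : ∀ᵐ x ∂(volume.restrict Ω), ‖f x‖ ≤ B)
    (hf0 : ∀ᵐ x ∂(volume.restrict Ω), 0 ≤ f x) (hφ : IsTestFunction U φ)
    (hφΩ : ∀ x ∈ Ω, φ x = 0) {u φ' v : Lp ℝ 2 (volume : Measure 𝔼)}
    (hφ' : φ' =ᵐ[volume] φ) (hχ : IsTestFunction Ω χ) (hv : v =ᵐ[volume] χ)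
    (hz : sobolevNormSq s (u - φ' - v) ≠ ⊤)
    (heq : fracLaplacian s u χ + ((∫ x in Ω, f x * u x * χ x : ℝ) : ℂ) = 0) :
    fracEnergy s χ ≤
      2 * (eLpNorm (fun ξ ↦ (fracSymbol s ξ : ℂ) * 𝓕 (fun x ↦ (φ x : ℂ)) ξ) 2 volume).toReal *
        ‖v‖ + (2 * π) ^ (2 * s) * (sobolevNormSq s (u - φ' - v)).toReal +
        2 * B * (‖u - φ' - v‖ * ‖v‖) := by
  set z := u - φ' - v with hzdef
  have hu : u = φ' + v + z := by rw [hzdef]; abel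
  have h1 := hφ.norm_fracLaplacian_le hs0 hs1 hφ' hχ hv
  have h2 := hχ.norm_fracLaplacian_le_add hs0 hs1 hz
  obtain ⟨hint, hzv⟩ := setIntegral_norm_mul_norm_le (Ω := Ω) z v
  -- On `Ω`, `u = v + z` because `φ = 0` there, so the integrand is `f v² + f z v`. The first term
  -- is nonnegative, and the bound `B` multiplies only the small error `z`.
  have h3 : -(B * (‖z‖ * ‖v‖)) ≤ ∫ x in Ω, f x * u x * χ x := by
    by_cases hi : IntegrableOn (fun x ↦ f x * u x * χ x) Ω
    · have h4 : ∫ x in Ω, -(B * (‖z x‖ * ‖v x‖)) ≤ ∫ x in Ω, f x * u x * χ x := by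
        refine integral_mono_ae (hint.const_mul B).neg hi ?_
        filter_upwards [hfB, hf0, ae_restrict_of_ae hφ', ae_restrict_of_ae hv,
          ae_restrict_of_ae (Lp.coeFn_sub (u - φ') v), ae_restrict_of_ae (Lp.coeFn_sub u φ'),
          ae_restrict_mem hΩ] with x a1 a2 a3 a4 a5 a6 a7
        have a8 : u x = v x + z x := by
          rw [hzdef, a5, Pi.sub_apply, a6, Pi.sub_apply, a3, hφΩ x a7]; ring
        rw [← a4, a8]
        have a9 : ‖f x * (z x * v x)‖ ≤ B * (‖z x‖ * ‖v x‖) := by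
          rw [norm_mul, norm_mul]; gcongr
        have a10 := neg_abs_le (f x * (z x * v x))
        rw [← Real.norm_eq_abs] at a10
        nlinarith [mul_nonneg a2 (sq_nonneg (v x))]
      rw [integral_neg, integral_const_mul] at h4
      have := mul_le_mul_of_nonneg_left hzv hB0
      linarith
    -- A non-integrable integrand has integral `0` by convention, and the bound is trivial.
    · rw [integral_undef hi]
      have : 0 ≤ B * (‖z‖ * ‖v‖) := by positivity
      linarith
  have h5 := heq
  rw [hu, hχ.fracLaplacian_add hs0 hs1, hχ.fracLaplacian_add hs0 hs1,
    hχ.fracLaplacian_self hv, ← hu] at h5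
  have h6 := congrArg Complex.re h5
  simp only [Complex.add_re, Complex.ofReal_re, Complex.zero_re] at h6
  have h7 := (abs_le.1 (Complex.abs_re_le_norm (fracLaplacian s φ' χ))).1
  have h8 := (abs_le.1 (Complex.abs_re_le_norm (fracLaplacian s z χ))).1
  linarith

end

variable {s δ : ℝ} {Ω D U : Set (EuclideanSpace ℝ (Fin d))}
  {w : Lp ℝ 2 (volume : Measure (EuclideanSpace ℝ (Fin d)))}
  {φ ψ : EuclideanSpace ℝ (Fin d) → ℝ}

/-- The solution is bounded in `L²` independently of the potential. -/
lemma norm_sub_le_of_isSolution (hs0 : 0 < s) (hs1 : s < 1) (hΩ : MeasurableSet Ω)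
    {P : ℝ} (hP0 : 0 ≤ P)
    (hP : ∀ (χ : 𝔼 → ℝ) (v : Lp ℝ 2 (volume : Measure 𝔼)), IsTestFunction Ω χ →
      v =ᵐ[volume] χ → ‖v‖ ^ 2 ≤ P * fracEnergy s χ)
    {f : 𝔼 → ℝ} {B : ℝ} (hB0 : 0 ≤ B) (hfB : ∀ᵐ x ∂(volume.restrict Ω), ‖f x‖ ≤ B)
    (hf0 : ∀ᵐ x ∂(volume.restrict Ω), 0 ≤ f x) (hφ : IsTestFunction U φ)
    (hφΩ : ∀ x ∈ Ω, φ x = 0) {u φ' : Lp ℝ 2 (volume : Measure 𝔼)}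
    (hφ' : φ' =ᵐ[volume] φ) (hw : MemHTilde s Ω (u - φ'))
    (heq : ∀ ψ : 𝔼 → ℝ, IsTestFunction Ω ψ →
      fracLaplacian s u ψ + ((∫ x in Ω, f x * u x * ψ x : ℝ) : ℂ) = 0) :
    ‖u - φ'‖ ≤ 2 * P *
      (eLpNorm (fun ξ ↦ (fracSymbol s ξ : ℂ) * 𝓕 (fun x ↦ (φ x : ℂ)) ξ) 2 volume).toReal := by
  set K := (eLpNorm (fun ξ ↦ (fracSymbol s ξ : ℂ) * 𝓕 (fun x ↦ (φ x : ℂ)) ξ) 2 volume).toReal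
    with hK
  have hK0 : 0 ≤ K := ENNReal.toReal_nonneg
  set w := u - φ' with hwdef
  obtain ⟨χ, v, hχ, hv, hlim⟩ := hw.exists_seq
  have hvw := tendsto_of_tendsto_sobolevNormSq hs0 hlim
  have hev : ∀ᶠ n in atTop, ‖v n‖ ^ 2 ≤ P * (2 * K * ‖v n‖ +
      (2 * π) ^ (2 * s) * (sobolevNormSq s (w - v n)).toReal + 2 * B * (‖w - v n‖ * ‖v n‖)) := by
    filter_upwards [hlim.eventually_lt_const ENNReal.zero_lt_top] with n hn
    exact (hP _ _ (hχ n) (hv n)).trans (mul_le_mul_of_nonneg_left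
      (fracEnergy_le_of_equation hs0 hs1 hΩ hB0 hfB hf0 hφ hφΩ hφ' (hχ n) (hv n) hn.ne
        (heq _ (hχ n))) hP0)
  have l1 : Tendsto (fun n ↦ ‖v n‖) atTop (𝓝 ‖w‖) := hvw.norm
  have l2 : Tendsto (fun n ↦ ‖w - v n‖) atTop (𝓝 0) := by
    have := (hvw.const_sub w).norm
    simpa using this
  have l3 : Tendsto (fun n ↦ (sobolevNormSq s (w - v n)).toReal) atTop (𝓝 0) :=
    (ENNReal.tendsto_toReal ENNReal.zero_ne_top).comp hlim
  -- In the limit the error terms, including the one with `B`, vanish and leave `‖w‖ ^ 2 ≤ P * (2 *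
  -- K * ‖w‖)`.
  have hle := le_of_tendsto_of_tendsto (l1.pow 2)
    ((((l1.const_mul (2 * K)).add (l3.const_mul ((2 * π) ^ (2 * s)))).add
      ((l2.mul l1).const_mul (2 * B))).const_mul P) hev
  rw [mul_zero, zero_mul, mul_zero, add_zero, add_zero] at hle
  rcases (norm_nonneg w).eq_or_lt with h0 | h0
  · rw [← h0]; positivity
  · nlinarith

/-! ### Pointwise representatives of `(-Δ)^s φ` and of the jump potential. -/

/-- The fractional Laplacian of a test function. -/
def fracLaplacianFun (s : ℝ) (φ : 𝔼 → ℝ) (x : 𝔼) : ℝ :=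
  (𝓕⁻ (fun ξ ↦ (fracSymbol s ξ : ℂ) * 𝓕 (fun x ↦ (φ x : ℂ)) ξ) x).re

/-- The symbol is real and even and `φ` is real, so the inverse transform is already real and taking
the real part loses nothing. -/
lemma ofReal_fracLaplacianFun (s : ℝ) (φ : 𝔼 → ℝ) (x : 𝔼) :
    (fracLaplacianFun s φ x : ℂ) =
      𝓕⁻ (fun ξ ↦ (fracSymbol s ξ : ℂ) * 𝓕 (fun x ↦ (φ x : ℂ)) ξ) x := by
  rw [fracLaplacianFun, ← Complex.conj_eq_iff_re, conj_fourierInv,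
    fourierInv_eq_fourier_comp_neg]
  refine congrArg (fun h : 𝔼 → ℂ ↦ 𝓕 h x) (funext fun ξ ↦ ?_)
  rw [map_mul, Complex.conj_ofReal, fracSymbol_neg, ← fourierInv_ofReal_eq_conj,
    fourierInv_eq_fourier_neg]

lemma abs_fracLaplacianFun_le (s : ℝ) (φ : 𝔼 → ℝ) (x : 𝔼) :
    |fracLaplacianFun s φ x| ≤
      ∫ ξ : 𝔼, ‖(fracSymbol s ξ : ℂ) * 𝓕 (fun x ↦ (φ x : ℂ)) ξ‖ :=
  (Complex.abs_re_le_norm _).trans (norm_fourierInv_le_integral _ x)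

lemma IsTestFunction.integrable_fracSymbol_mul_fourier (hφ : IsTestFunction U φ) (hs0 : 0 < s)
    (hs1 : s < 1) :
    Integrable (fun ξ ↦ (fracSymbol s ξ : ℂ) * 𝓕 (fun x ↦ (φ x : ℂ)) ξ) :=
  memLp_one_iff_integrable.1 (hφ.memLp_fracSymbol_mul_fourier hs0 hs1 1)

lemma IsTestFunction.continuous_fracLaplacianFun (hφ : IsTestFunction U φ) (hs0 : 0 < s)
    (hs1 : s < 1) : Continuous (fracLaplacianFun s φ) :=
  Complex.continuous_re.comp (continuous_fourierInv_of_integrable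
    (hφ.integrable_fracSymbol_mul_fourier hs0 hs1))

lemma IsTestFunction.fracLaplacian_eq_integral (hφ : IsTestFunction U φ) (hs0 : 0 < s)
    (hs1 : s < 1) {φ' : Lp ℝ 2 (volume : Measure 𝔼)} (hφ' : φ' =ᵐ[volume] φ)
    (hψ : IsTestFunction D ψ) :
    fracLaplacian s φ' ψ = ((∫ x, fracLaplacianFun s φ x * ψ x : ℝ) : ℂ) := by
  have h := integral_fourierInv_mul_eq_flip hψ.integrable_ofReal
    (hφ.integrable_fracSymbol_mul_fourier hs0 hs1)
  rw [← integral_complex_ofReal]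
  calc fracLaplacian s φ' ψ = ∫ ξ, 𝓕⁻ (fun x ↦ (ψ x : ℂ)) ξ *
        ((fracSymbol s ξ : ℂ) * 𝓕 (fun x ↦ (φ x : ℂ)) ξ) := by
        refine integral_congr_ae ?_
        filter_upwards [hφ.fourier_complexify_ae hφ'] with ξ hξ
        rw [hξ, ← fracSymbol, mul_comm]
    _ = _ := h
    _ = _ := by
        congr 1; ext x
        rw [← ofReal_fracLaplacianFun, Complex.ofReal_mul, mul_comm]

/-- The potential of `v` for the jump kernel. -/
def jumpPotential (s : ℝ) (v : 𝔼 → ℝ) (x : 𝔼) : ℝ :=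
  ∫ y, v y * jumpKernel d s ‖x - y‖

lemma stronglyMeasurable_jumpPotential (s : ℝ) {v : 𝔼 → ℝ} (hv : StronglyMeasurable v) :
    StronglyMeasurable (jumpPotential s v) := by
  have h : StronglyMeasurable fun p : 𝔼 × 𝔼 ↦ v p.2 * jumpKernel d s ‖p.1 - p.2‖ :=
    ((hv.measurable.comp measurable_snd).mul
      ((measurable_jumpKernel s).comp (by fun_prop))).stronglyMeasurable
  exact h.integral_prod_right

lemma abs_jumpPotential_le (hs0 : 0 < s) (hs1 : s < 1) (hδ : 0 < δ)
    (hsep : ∀ y ∈ Ω, ∀ x ∈ D, δ ≤ ‖x - y‖) {v : 𝔼 → ℝ} (hv : Integrable v)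
    (hv0 : ∀ x ∉ Ω, v x = 0) {x : 𝔼} (hx : x ∈ D) :
    |jumpPotential s v x| ≤ jumpKernel d s δ * ∫ y, ‖v y‖ := by
  rw [jumpPotential, ← integral_const_mul, ← Real.norm_eq_abs]
  refine norm_integral_le_of_norm_le (hv.norm.const_mul _) (ae_of_all _ fun y ↦ ?_)
  by_cases hy : y ∈ Ω
  · rw [norm_mul, mul_comm, norm_of_nonneg (jumpKernel_nonneg hs0 hs1 _)]
    exact mul_le_mul_of_nonneg_right (jumpKernel_le_jumpKernel hs0 hs1 hδ (hsep y hy x hx))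
      (norm_nonneg _)
  · simp [hv0 y hy]

lemma jumpForm_eq_integral (hs0 : 0 < s) (hs1 : s < 1) (hδ : 0 < δ)
    (hsep : ∀ y ∈ Ω, ∀ x ∈ D, δ ≤ ‖x - y‖) {v ψ : 𝔼 → ℝ} (hv : Integrable v) (hψ : Integrable ψ)
    (hv0 : ∀ x ∉ Ω, v x = 0) (hψ0 : ∀ x ∉ D, ψ x = 0) :
    Integrable (fun x ↦ jumpPotential s v x * ψ x) ∧
      jumpForm s v ψ = ∫ x, jumpPotential s v x * ψ x := by
  have hint := integrable_jumpForm hs0 hs1 hδ hsep hv hψ hv0 hψ0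
  have hinner : ∀ x, ∫ y, v y * ψ x * jumpKernel d s ‖x - y‖ = jumpPotential s v x * ψ x := by
    intro x
    rw [jumpPotential, ← integral_mul_const]
    congr 1; ext y; ring
  constructor
  · exact hint.integral_prod_right.congr (ae_of_all _ hinner)
  · rw [jumpForm, Measure.volume_eq_prod, integral_prod_symm _ hint]
    simp only [hinner]

lemma setDist_le_norm_sub {Ω D : Set 𝔼} {y x : 𝔼} (hy : y ∈ Ω) (hx : x ∈ D) :
    setDist Ω D ≤ ‖x - y‖ := by
  rw [← dist_eq_norm, dist_comm]
  exact csInf_le ⟨0, by rintro _ ⟨a, -, b, -, rfl⟩; exact dist_nonneg⟩ (mem_image2_of_mem hy hx)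

lemma setDist_pos {Ω D : Set 𝔼} (hΩ : IsBoundedSmoothDomain Ω) (hD : IsBoundedSmoothDomain D)
    (h : closure D ∩ closure Ω = ∅) : 0 < setDist Ω D := by
  obtain ⟨r, hr0, hr⟩ := Metric.exists_pos_forall_lt_edist hΩ.isBounded.isCompact_closure
    (isClosed_closure (s := D)) (disjoint_iff_inter_eq_empty.2 (by rwa [inter_comm]))
  refine lt_of_lt_of_le (NNReal.coe_pos.2 hr0) (le_csInf
    (hΩ.isConnected.nonempty.image2 hD.isConnected.nonempty) ?_)
  rintro _ ⟨a, ha, b, hb, rfl⟩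
  have := (hr a (subset_closure ha) b (subset_closure hb)).le
  rw [edist_nndist, ENNReal.coe_le_coe] at this
  exact_mod_cast this

end FracSchrodinger

end

/-! ### The uniform bound. -/

open FracSchrodinger

theorem mainTheorem7 (d : ℕ) (hd : 1 ≤ d) (s : ℝ) (hs0 : 0 < s) (hs1 : s < 1)
    (φ : EuclideanSpace ℝ (Fin d) → ℝ) (m δ : ℝ) :
    ∃ C : ℝ, 0 < C ∧
      ∀ Ω D : Set (EuclideanSpace ℝ (Fin d)),
        FracSchrodinger.IsBoundedSmoothDomain Ω →
        FracSchrodinger.IsBoundedSmoothDomain D →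
        closure D ∩ closure Ω = ∅ →
        (volume Ω).toReal = m →
        FracSchrodinger.setDist Ω D = δ →
        FracSchrodinger.IsTestFunction (closure Ω)ᶜ φ →
        ∀ f : EuclideanSpace ℝ (Fin d) → ℝ,
          MemLp f ∞ (volume.restrict Ω) →
          (∀ᵐ x ∂(volume.restrict Ω), 0 ≤ f x) →
          ∀ u : Lp ℝ 2 (volume : Measure (EuclideanSpace ℝ (Fin d))),
            FracSchrodinger.IsSolution s Ω f φ u →
            ∃ g : EuclideanSpace ℝ (Fin d) → ℝ,
              FracSchrodinger.FracLaplacianEqOn s u D g ∧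
              eLpNorm g ∞ (volume.restrict D) ≤ ENNReal.ofReal C := by
  -- The constants are chosen before `Ω` is given, when `m` may still be negative; hence `|m|`,
  -- which equals `m` once `m` is a measure.
  obtain ⟨P, hP0, hP⟩ := exists_poincare_const hd hs0 hs1 |m| (abs_nonneg m)
  set K := (eLpNorm (fun ξ : EuclideanSpace ℝ (Fin d) ↦
    (fracSymbol s ξ : ℂ) * 𝓕 (fun x ↦ (φ x : ℂ)) ξ) 2 volume).toReal with hK
  set M := ∫ ξ : EuclideanSpace ℝ (Fin d), ‖(fracSymbol s ξ : ℂ) * 𝓕 (fun x ↦ (φ x : ℂ)) ξ‖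
    with hM
  have hK0 : 0 ≤ K := ENNReal.toReal_nonneg
  have hM0 : 0 ≤ M := integral_nonneg fun _ ↦ norm_nonneg _
  have hk0 := jumpKernel_nonneg (d := d) hs0 hs1 δ
  -- `M` bounds `(-Δ)^s φ`, `2 * P * K` bounds `‖w‖`, and `√m` comes from Cauchy–Schwarz on `Ω`; the
  -- `1` only makes the constant positive.
  refine ⟨M + jumpKernel d s δ * (√m * (2 * P * K)) + 1, by positivity, ?_⟩
  intro Ω D hΩ hD hdisj hvol hdist hφ f hf hf0 u hu
  have hδ : 0 < δ := hdist ▸ setDist_pos hΩ hD hdisj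
  have hsep : ∀ y ∈ Ω, ∀ x ∈ D, δ ≤ ‖x - y‖ := fun y hy x hx ↦
    hdist ▸ setDist_le_norm_sub hy hx
  have hΩm := hΩ.isOpen.measurableSet
  have hfin : volume Ω ≠ ⊤ := hΩ.isBounded.measure_lt_top.ne
  have hm : |m| = m := abs_of_nonneg (hvol ▸ ENNReal.toReal_nonneg)
  obtain ⟨φ', hφ', hw⟩ := hu.exterior
  have hφΩ : ∀ x ∈ Ω, φ x = 0 := fun x hx ↦
    hφ.eq_zero_of_notMem fun h ↦ h (subset_closure hx)
  have hfB : ∀ᵐ x ∂(volume.restrict Ω), ‖f x‖ ≤ (eLpNorm f ∞ (volume.restrict Ω)).toReal := by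
    rw [eLpNorm_exponent_top]
    filter_upwards [ae_le_eLpNormEssSup (f := f) (μ := volume.restrict Ω)] with x hx
    rw [← toReal_enorm]
    exact ENNReal.toReal_mono (by simpa using hf.eLpNorm_ne_top) hx
  have hnorm := norm_sub_le_of_isSolution hs0 hs1 hΩm hP0
    (fun χ v ↦ hP Ω χ v hΩm hfin (hvol.trans hm.symm)) ENNReal.toReal_nonneg hfB hf0 hφ hφΩ hφ' hw
    hu.equation
  set w := u - φ' with hwdef
  set v := Ω.indicator w with hv
  have hvint : Integrable v := (integrable_indicator_iff hΩm).2 (integrableOn_of_L2 hfin w)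
  have hv0 : ∀ x ∉ Ω, v x = 0 := fun x hx ↦ Set.indicator_of_notMem hx _
  have hvm : StronglyMeasurable v := (Lp.stronglyMeasurable w).indicator hΩm
  have hvL1 : ∫ y, ‖v y‖ ≤ √m * (2 * P * K) := by
    have h1 : ∫ y, ‖v y‖ = ∫ y in Ω, ‖w y‖ := by
      simp only [hv, norm_indicator_eq_indicator_norm]
      rw [integral_indicator hΩm]
    rw [h1, ← hvol]
    exact (setIntegral_norm_le_sqrt_mul_norm hfin w).trans (by gcongr)
  have hbound : ∀ᵐ x ∂(volume.restrict D), ‖fracLaplacianFun s φ x - jumpPotential s v x‖ ≤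
      M + jumpKernel d s δ * (√m * (2 * P * K)) + 1 := by
    filter_upwards [ae_restrict_mem hD.isOpen.measurableSet] with x hx
    have h1 := abs_fracLaplacianFun_le s φ x
    have h2 := (abs_jumpPotential_le hs0 hs1 hδ hsep hvint hv0 hx).trans
      (mul_le_mul_of_nonneg_left hvL1 hk0)
    refine (norm_sub_le _ _).trans ?_
    rw [Real.norm_eq_abs, Real.norm_eq_abs]
    linarith
  have hmeas : AEStronglyMeasurable (fun x ↦ fracLaplacianFun s φ x - jumpPotential s v x)
      (volume.restrict D) :=
    (hφ.continuous_fracLaplacianFun hs0 hs1).aestronglyMeasurable.sub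
      (stronglyMeasurable_jumpPotential s hvm).aestronglyMeasurable
  -- The two terms represent `(-Δ)^s φ` and `(-Δ)^s w` on `D`.
  refine ⟨fun x ↦ fracLaplacianFun s φ x - jumpPotential s v x,
    ⟨memLp_top_of_bound hmeas _ hbound, fun ψ hψ ↦ ?_⟩, ?_⟩
  · have hψ0 : ∀ x ∉ D, ψ x = 0 := fun x hx ↦ hψ.eq_zero_of_notMem hx
    obtain ⟨hi, hj⟩ := jumpForm_eq_integral hs0 hs1 hδ hsep hvint hψ.integrable hv0 hψ0
    have hi' : Integrable fun x ↦ fracLaplacianFun s φ x * ψ x :=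
      hψ.integrable.bdd_mul (hφ.continuous_fracLaplacianFun hs0 hs1).aestronglyMeasurable
        (ae_of_all _ fun x ↦ abs_fracLaplacianFun_le s φ x)
    have hu' : u = φ' + w := by rw [hwdef]; abel
    rw [hu', hψ.fracLaplacian_add hs0 hs1, hφ.fracLaplacian_eq_integral hs0 hs1 hφ' hψ,
      hw.fracLaplacian_eq_neg_jumpForm hs0 hs1 hδ hΩm hfin hsep hψ, ← Complex.ofReal_add, hj,
      ← sub_eq_add_neg, ← integral_sub hi' hi,
      setIntegral_eq_integral_of_forall_compl_eq_zero fun x hx ↦ by rw [hψ0 x hx, mul_zero]]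
    simp only [sub_mul]
  · rw [eLpNorm_exponent_top]
    exact eLpNormEssSup_le_of_ae_bound hbound
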